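/- Let $d\in\mathbb N$ and let $K\in\mathbb R^{d\times d}$ be symmetric positive definite. Put $$f_{\infty,K}(x)=\frac{\det(K)^{-1/2}}{(2\pi)^{d/2}}\exp\Big(-\frac{x^TK^{-1}x}{2}\Big),\qquad \mathcal H=L^2(\mathbb R^d,f_{\infty,K}^{-1}\,dx;\mathbb R),\qquad V_0=\operatorname{span}\{f_{\infty,K}\}\subset\mathcal H,$$ and let $V_0^\perp$ be the orthogonal complement of $V_0$ in $\mathcal H$. Let $\mathcal I(K)$ be the set of all pairs $(C,D)$ of real $d\times d$ matrices with $D$ symmetric positive semi-definite, $\operatorname{Tr}(D)\le d$ and $\operatorname{div}(D\nabla f_{\infty,K}+Cx f_{\infty,K})=0$ on $\mathbb R^d$. Let $t\mapsto C(t)$ and $t\mapsto D(t)$, $t\ge 0$, be piecewise smooth (smooth up to the end points between consecutive break points, which do not accumulate; values at break points are arbitrary) with $(C(t),D(t))\in\mathcal I(K)$ for all $t\ge0$. Consider the Fokker–Planck equation $$\partial_t f_t=\operatorname{div}_x\big(D(t)\nabla_x f_t+C(t)x f_t\big)\qquad(\mathrm{FP})$$ where a solution on $[s,\infty)$ is an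 $f\in C([s,\infty);\mathcal H)$ such that, for all $\varphi\in C_c^\infty(\mathbb R^d)$ and $t\ge s$, $$\int f_t\varphi\,dx-\int f_s\varphi\,dx=\int_s^t\int f_r\,\big(\operatorname{div}(D(r)\nabla\varphi)-C(r)x\cdot\nabla\varphi\big)\,dx\,dr .$$ Assume that for every $f_0\in\mathcal H$ the initial value problem for (FP) with datum $f_0$ at time $0$ has a unique solution in $C([0,\infty);\mathcal H)$. Then for all $0\le t_1\le t_2<\infty$ the propagator $S(t_2,t_1)$ of (FP) and the propagator $T(t_2,t_1)$ of the drift ODE $$\frac{d}{dt}x=-\widetilde C(t)x,\qquad \widetilde C(t)=K^{-1/2}C(t)K^{1/2},$$ which map an initial condition at time $t_1$ to the value at time $t_2$ of the corresponding solution on $[t_1,\infty)$ (for the ODE: continuous and satisfying the time-integrated equation), are well-defined bounded linear operators on $\mathcal H$ and on $\mathbb R^d$ respectively, $S(t_2,t_1)$ maps $V_0^\perp$ into itself, and $$\|S(t_2,t_1)\|_{\mathcal B(V_0^\perp)}=\|T(t_2,t_1)\|_{\mathcal B(\mathbb R^d)},$$ where the left side is the operator norm of $S(t_2,t_1)$ restricted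 to $V_0^\perp$ in the norm of $\mathcal H$ and the right side is the spectral norm. -/

import Mathlib

open MeasureTheory Filter Topology Set
open scoped ContDiff Matrix RealInnerProductSpace

namespace FokkerPlanck

/-- The Euclidean space `ℝ^d`. -/
abbrev Space (d : ℕ) : Type := EuclideanSpace ℝ (Fin d)

variable {d : ℕ}

/-- The matrix-vector product `A x`, as a vector of the Euclidean space. -/
noncomputable def mulVecE (A : Matrix (Fin d) (Fin d) ℝ) (x : Space d) : Space d :=
  Matrix.toEuclideanLin A x

/-- The divergence `∑ i, ∂_i F_i` of a vector field on `ℝ^d`. -/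
noncomputable def divergence (F : Space d → Space d) (x : Space d) : ℝ :=
  ∑ i, (fderiv ℝ F x (EuclideanSpace.single i 1)) i

/-- The Gaussian density `f_{∞,K}` with mean zero and covariance matrix `K`. -/
noncomputable def fInf (K : Matrix (Fin d) (Fin d) ℝ) (x : Space d) : ℝ :=
  K.det ^ (-(1 / 2) : ℝ) / (2 * Real.pi) ^ ((d : ℝ) / 2) *
    Real.exp (-(⟪x, mulVecE K⁻¹ x⟫ / 2))

/-- The Fokker-Planck operator in divergence form,
`-L_{C,D} f = div (D ∇f + C x f)`, acting on smooth functions. -/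
noncomputable def negL (C D : Matrix (Fin d) (Fin d) ℝ) (f : Space d → ℝ) (x : Space d) : ℝ :=
  divergence (fun y => mulVecE D (gradient f y) + f y • mulVecE C y) x

/-- The set `I(K)` of all pairs `(C, D)` with `D` symmetric positive semi-definite,
`Tr D ≤ d`, and `L_{C,D} f_{∞,K} = 0`. -/
def admissible (K : Matrix (Fin d) (Fin d) ℝ) :
    Set (Matrix (Fin d) (Fin d) ℝ × Matrix (Fin d) (Fin d) ℝ) :=
  {P | P.2.PosSemidef ∧ P.2.trace ≤ d ∧ ∀ x, negL P.1 P.2 (fInf K) x = 0}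

/-- The measure `f_{∞,K}(x)⁻¹ dx`. -/
noncomputable def weight (K : Matrix (Fin d) (Fin d) ℝ) : Measure (Space d) :=
  volume.withDensity fun x => ENNReal.ofReal (fInf K x)⁻¹

/-- The Hilbert space `H = L²(ℝ^d, f_{∞,K}⁻¹)` of real functions. -/
abbrev H (K : Matrix (Fin d) (Fin d) ℝ) : Type := Lp ℝ 2 (weight K)

/-- `V₀ = span {f_{∞,K}} ⊆ H`: the set that is spanned consists of the class of `f_{∞,K}`. -/
noncomputable def V0 (K : Matrix (Fin d) (Fin d) ℝ) : Submodule ℝ (H K) :=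
  Submodule.span ℝ {g : H K | g =ᵐ[weight K] fInf K}

/-- A matrix-valued function of `t ≥ 0` is piecewise smooth: there are break points
`0 = τ 0 < τ 1 < ⋯ → ∞` such that between two consecutive ones all entries agree with functions
that are smooth up to the end points. The values at the break points are arbitrary. -/
def PiecewiseSmooth (A : ℝ → Matrix (Fin d) (Fin d) ℝ) : Prop :=
  ∃ τ : ℕ → ℝ, τ 0 = 0 ∧ StrictMono τ ∧ Tendsto τ atTop atTop ∧
    ∀ n i j, ∃ g : ℝ → ℝ, ContDiffOn ℝ ∞ g (Icc (τ n) (τ (n + 1))) ∧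
      EqOn (fun t => A t i j) g (Ioo (τ n) (τ (n + 1)))

/-- The formal adjoint of `-L_{C,D}` (for symmetric `D`),
`φ ↦ div (D ∇φ) - (C x) · ∇φ`, acting on test functions. -/
noncomputable def negLAdjoint (C D : Matrix (Fin d) (Fin d) ℝ) (φ : Space d → ℝ)
    (x : Space d) : ℝ :=
  divergence (fun y => mulVecE D (gradient φ y)) x - ⟪mulVecE C x, gradient φ x⟫

/-- `f ∈ C([s,∞); H)` is a weak (distributional) solution of the Fokker-Planck equation
`∂_t f = div (D(t) ∇f + C(t) x f)` on `(s,∞) × ℝ^d`; the equation is integrated in time, as the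
coefficients may jump. Only the values of `f` on `[s,∞)` matter. -/
def IsFPSolution (K : Matrix (Fin d) (Fin d) ℝ) (C D : ℝ → Matrix (Fin d) (Fin d) ℝ)
    (s : ℝ) (f : ℝ → H K) : Prop :=
  ContinuousOn f (Ici s) ∧
    ∀ φ : Space d → ℝ, ContDiff ℝ ∞ φ → HasCompactSupport φ → ∀ t, s ≤ t →
      (∫ x, f t x * φ x) - (∫ x, f s x * φ x) =
        ∫ r in s..t, ∫ x, f r x * negLAdjoint (C r) (D r) φ x

/-- The initial value problem for the Fokker-Planck equation has, for every initial datum in `H`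
at time `0`, a unique solution in `C([0,∞); H)`. -/
def IsWellPosed (K : Matrix (Fin d) (Fin d) ℝ) (C D : ℝ → Matrix (Fin d) (Fin d) ℝ) : Prop :=
  ∀ f₀ : H K, (∃ f, IsFPSolution K C D 0 f ∧ f 0 = f₀) ∧
    ∀ f g, IsFPSolution K C D 0 f → f 0 = f₀ → IsFPSolution K C D 0 g → g 0 = f₀ →
      EqOn f g (Ici 0)

/-- `S` is the propagator `S(t₂,t₁)` of the Fokker-Planck equation: every datum in `H` at time
`t₁` is the initial value of a solution on `[t₁,∞)`, and `S` maps it to the value at time `t₂` of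
any such solution. At most one `S` has this property. -/
def IsFPPropagator (K : Matrix (Fin d) (Fin d) ℝ) (C D : ℝ → Matrix (Fin d) (Fin d) ℝ)
    (t₂ t₁ : ℝ) (S : H K →L[ℝ] H K) : Prop :=
  ∀ g : H K, (∃ f, IsFPSolution K C D t₁ f ∧ f t₁ = g) ∧
    ∀ f, IsFPSolution K C D t₁ f → f t₁ = g → f t₂ = S g

open scoped MatrixOrder in
/-- `K^{-1/2} C K^{1/2}`, with the positive (semi-)definite square root of `K`. -/
noncomputable def conjSqrt (K C : Matrix (Fin d) (Fin d) ℝ) : Matrix (Fin d) (Fin d) ℝ :=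
  (CFC.sqrt K)⁻¹ * C * CFC.sqrt K

/-- `x` is a continuous solution on `[s,∞)` of the linear ODE `x' = -A(t) x`; the equation is
integrated in time, as the coefficients may jump. -/
def IsODESolution (A : ℝ → Matrix (Fin d) (Fin d) ℝ) (s : ℝ) (x : ℝ → Space d) : Prop :=
  ContinuousOn x (Ici s) ∧ ∀ t, s ≤ t → x t - x s = ∫ r in s..t, -mulVecE (A r) (x r)

/-- `T` is the propagator `T(t₂,t₁)` of the ODE `x' = -A(t) x`: every vector is the initial value
at time `t₁` of a solution on `[t₁,∞)`, and `T` maps it to the value at time `t₂` of any such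
solution. At most one `T` has this property. -/
def IsODEPropagator (A : ℝ → Matrix (Fin d) (Fin d) ℝ) (t₂ t₁ : ℝ)
    (T : Space d →L[ℝ] Space d) : Prop :=
  ∀ x₀ : Space d, (∃ x, IsODESolution A t₁ x ∧ x t₁ = x₀) ∧
    ∀ x, IsODESolution A t₁ x → x t₁ = x₀ → x t₂ = T x₀

end FokkerPlanck

/-!
The reason is that the Fokker-Planck propagator is the second quantization of the drift propagator.

Stationarity of the Gaussian `fInf K` splits the drift as `C = D K⁻¹ + N`, where `N` has trace zero
and is tangential to the level sets of `x ↦ ⟪x, K⁻¹ x⟫` (`trace_eq_zero_and_inner_eq_zero`). Hence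
`⟪a, C̃ a⟫ ≥ 0` for `C̃ = K^{-1/2} C K^{1/2}`, so that the propagator `T` of `a' = -C̃ a` is a
contraction (`inner_conjSqrt_nonneg`, `IsTame.norm_caratheodorySol_le`), and the equation transports a Gaussian
density with covariance `K` and mean `m` to the one with mean `m(t)`, where `m' = -C m`
(`integral_expVec_sub_eq`).

With `m = K^{1/2} a` these densities `expVec a` satisfy `⟪expVec a, expVec b⟫ = κ exp ⟪a, b⟫` for a
constant `κ > 0`, they are total in `H` (`dense_span_expVec`), and `V0` is spanned by `expVec 0`.
They are moved by `expVec a ↦ expVec (T a)`. By the Schur product theorem the kernel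
`ρ² (exp ⟪a, b⟫ - 1) - (exp ⟪T a, T b⟫ - 1)` is positive semi-definite whenever `‖T‖ ≤ ρ ≤ 1`
(`posSemidef_sub_gram_exp`). With `ρ = 1` this yields a bounded operator `Γ(T)` on `H` with
`expVec a ↦ expVec (T a)` (`exists_secondQuantization`), and with `ρ = ‖T‖` it bounds `Γ(T)` on
`V0ᗮ` by `‖T‖`. The reverse bound follows from the vectors `expVec (√s a) - expVec 0` as `s → 0`
(`norm_secondQuantization_comp_subtypeL`).

By density `t ↦ Γ(T(t, t₁)) g` solves the equation for each datum `g` at time `t₁`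
(`isFPSolution_of_expVec`). Uniqueness from time `t₁` is inherited from uniqueness from time `0`
through extension by zero (`IsWellPosed.eq_of_isFPSolution`).
-/

namespace FokkerPlanck

/-! ### Second quantization of a contraction -/

section SecondQuantization

variable {E X : Type*} [NormedAddCommGroup E] [InnerProductSpace ℝ E]
  [NormedAddCommGroup X] [InnerProductSpace ℝ X]

theorem sum_inner_eq_norm_sq {ι : Type*} (f : ι → X) (c : ι →₀ ℝ) :
    (c.sum fun i ci => c.sum fun j cj => star ci * ⟪f i, f j⟫ * cj) =
      ‖Finsupp.linearCombination ℝ f c‖ ^ 2 := by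
  rw [← real_inner_self_eq_norm_sq, Finsupp.linearCombination_apply, Finsupp.sum_inner]
  refine Finsupp.sum_congr fun i _ => ?_
  rw [Finsupp.inner_sum]
  refine Finsupp.sum_congr fun j _ => ?_
  simp [inner_smul_right, inner_smul_left]
  ring

theorem posSemidef_gram {ι : Type*} (f : ι → X) :
    (Matrix.of fun i j => ⟪f i, f j⟫ : Matrix ι ι ℝ).PosSemidef := by
  refine ⟨?_, fun c => ?_⟩
  · ext i j
    simp [real_inner_comm]
  · simp only [Matrix.of_apply]
    rw [sum_inner_eq_norm_sq]
    positivity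

theorem posSemidef_sub_gram {M : E →L[ℝ] E} {ρ : ℝ} (hM : ‖M‖ ≤ ρ) :
    (Matrix.of fun a b => ρ ^ 2 * ⟪a, b⟫ - ⟪M a, M b⟫ : Matrix E E ℝ).PosSemidef := by
  refine ⟨?_, fun c => ?_⟩
  · ext i j
    simp [real_inner_comm]
  · have h1 := sum_inner_eq_norm_sq (fun a : E => a) c
    have h2 := sum_inner_eq_norm_sq (fun a : E => M a) c
    have h3 : Finsupp.linearCombination ℝ (fun a : E => M a) c =
        M (Finsupp.linearCombination ℝ (fun a : E => a) c) := by
      simp [Finsupp.linearCombination_apply, Finsupp.sum, map_sum]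
    have h4 : (c.sum fun i ci => c.sum fun j cj =>
        star ci * (Matrix.of fun a b => ρ ^ 2 * ⟪a, b⟫ - ⟪M a, M b⟫ : Matrix E E ℝ) i j * cj) =
        ρ ^ 2 * (c.sum fun i ci => c.sum fun j cj => star ci * ⟪i, j⟫ * cj) -
          (c.sum fun i ci => c.sum fun j cj => star ci * ⟪M i, M j⟫ * cj) := by
      simp only [Finsupp.sum, Finset.mul_sum, ← Finset.sum_sub_distrib]
      refine Finset.sum_congr rfl fun i _ => Finset.sum_congr rfl fun j _ => ?_
      simp only [Matrix.of_apply]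
      ring
    rw [h4, h1, h2, h3]
    have h5 := M.le_of_opNorm_le hM (Finsupp.linearCombination ℝ (fun a : E => a) c)
    have h6 := pow_le_pow_left₀ (norm_nonneg _) h5 2
    rw [mul_pow] at h6
    linarith

/-- By the Schur product theorem the inequality `⟪M a, M b⟫ ≤ ρ² ⟪a, b⟫` between positive
semi-definite kernels passes to the entrywise powers. The constant stays `ρ²`, as `ρ ≤ 1`. -/
theorem posSemidef_sub_gram_pow {M : E →L[ℝ] E} {ρ : ℝ} (hM : ‖M‖ ≤ ρ) (hρ : ρ ≤ 1) (m : ℕ) :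
    (Matrix.of fun a b => ρ ^ 2 * ⟪a, b⟫ ^ (m + 1) - ⟪M a, M b⟫ ^ (m + 1) :
      Matrix E E ℝ).PosSemidef := by
  have hl : ∀ m : ℕ, (Matrix.of fun a b => ⟪M a, M b⟫ ^ (m + 1) : Matrix E E ℝ).PosSemidef := by
    intro m
    induction m with
    | zero => simpa using posSemidef_gram fun a => M a
    | succ m ih =>
      have heq : (Matrix.of fun a b => ⟪M a, M b⟫ ^ (m + 1 + 1) : Matrix E E ℝ) =
          (Matrix.of fun a b => ⟪M a, M b⟫ ^ (m + 1)) ⊙ (Matrix.of fun a b => ⟪M a, M b⟫) := by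
        ext a b
        simp [pow_succ]
      rw [heq]
      exact ih.hadamard (posSemidef_gram fun a => M a)
  have hk := posSemidef_gram fun a : E => a
  have hkl := posSemidef_sub_gram (hM.trans hρ)
  induction m with
  | zero => simpa using posSemidef_sub_gram hM
  | succ m ih =>
    -- `ρ² k^(m+2) - l^(m+2) = (ρ² k^(m+1) - l^(m+1)) k + l^(m+1) (k - l)`
    have heq : (Matrix.of fun a b => ρ ^ 2 * ⟪a, b⟫ ^ (m + 1 + 1) - ⟪M a, M b⟫ ^ (m + 1 + 1) :
        Matrix E E ℝ) =
        (Matrix.of fun a b => ρ ^ 2 * ⟪a, b⟫ ^ (m + 1) - ⟪M a, M b⟫ ^ (m + 1)) ⊙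
            (Matrix.of fun a b => ⟪a, b⟫) +
          (Matrix.of fun a b => ⟪M a, M b⟫ ^ (m + 1)) ⊙
            (Matrix.of fun a b => 1 ^ 2 * ⟪a, b⟫ - ⟪M a, M b⟫) := by
      ext a b
      simp
      ring
    rw [heq]
    exact (ih.hadamard hk).add ((hl m).hadamard hkl)

theorem posSemidef_sub_gram_exp {M : E →L[ℝ] E} {ρ : ℝ} (hM : ‖M‖ ≤ ρ) (hρ : ρ ≤ 1) :
    (Matrix.of fun a b => ρ ^ 2 * (Real.exp ⟪a, b⟫ - 1) - (Real.exp ⟪M a, M b⟫ - 1) :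
      Matrix E E ℝ).PosSemidef := by
  refine ⟨?_, fun c => ?_⟩
  · ext i j
    simp [real_inner_comm]
  · have hexp : ∀ x : ℝ, HasSum (fun m : ℕ => x ^ (m + 1) / (m + 1).factorial)
        (Real.exp x - 1) := by
      intro x
      have := NormedSpace.expSeries_div_hasSum_exp x
      rw [← Real.exp_eq_exp_ℝ] at this
      simpa using (hasSum_nat_add_iff' 1).2 this
    have hs : HasSum (fun m : ℕ => (1 / ((m + 1).factorial : ℝ)) *
        (c.sum fun i ci => c.sum fun j cj => star ci *
          (Matrix.of fun a b => ρ ^ 2 * ⟪a, b⟫ ^ (m + 1) - ⟪M a, M b⟫ ^ (m + 1) :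
            Matrix E E ℝ) i j * cj))
        (c.sum fun i ci => c.sum fun j cj => star ci *
          (Matrix.of fun a b => ρ ^ 2 * (Real.exp ⟪a, b⟫ - 1) - (Real.exp ⟪M a, M b⟫ - 1) :
            Matrix E E ℝ) i j * cj) := by
      simp only [Finsupp.sum, Finset.mul_sum]
      refine hasSum_sum fun i _ => hasSum_sum fun j _ => ?_
      simp only [Matrix.of_apply]
      convert ((((hexp ⟪i, j⟫).mul_left (ρ ^ 2)).sub (hexp ⟪M i, M j⟫)).mul_left
        (star (c i))).mul_right (c j) using 2 with m
      · rfl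
      · ring
    exact hs.nonneg fun m => mul_nonneg (by positivity)
      ((posSemidef_sub_gram_pow hM hρ m).2 c)

theorem norm_linearCombination_sub_sq {e : E → X} {κ : ℝ}
    (he : ∀ a b, ⟪e a, e b⟫ = κ * Real.exp ⟪a, b⟫) (c : E →₀ ℝ) :
    ‖Finsupp.linearCombination ℝ (fun a => e a - e 0) c‖ ^ 2 =
      κ * (c.sum fun i ci => c.sum fun j cj => star ci * (Real.exp ⟪i, j⟫ - 1) * cj) := by
  rw [← sum_inner_eq_norm_sq]
  simp only [Finsupp.sum, Finset.mul_sum]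
  refine Finset.sum_congr rfl fun i _ => Finset.sum_congr rfl fun j _ => ?_
  simp only [inner_sub_left, inner_sub_right, he, inner_zero_left, inner_zero_right, Real.exp_zero]
  ring

/-- The vectors `e a - e 0` are the projections of the exponential vectors to the complement of
`e 0`; on their span `e a ↦ e (M a)` has the bound `ρ`. -/
theorem norm_linearCombination_sub_le {e : E → X} {κ : ℝ} (hκ : 0 < κ)
    (he : ∀ a b, ⟪e a, e b⟫ = κ * Real.exp ⟪a, b⟫)
    {M : E →L[ℝ] E} {ρ : ℝ} (hM : ‖M‖ ≤ ρ) (hρ : ρ ≤ 1) (c : E →₀ ℝ) :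
    ‖Finsupp.linearCombination ℝ (fun a => e (M a) - e 0) c‖ ≤
      ρ * ‖Finsupp.linearCombination ℝ (fun a => e a - e 0) c‖ := by
  have hρ0 : 0 ≤ ρ := (norm_nonneg _).trans hM
  have h := (posSemidef_sub_gram_exp hM hρ).2 c
  refine le_of_sq_le_sq ?_ (by positivity)
  rw [mul_pow, norm_linearCombination_sub_sq he, ← sum_inner_eq_norm_sq]
  have h2 : (c.sum fun i ci => c.sum fun j cj =>
      star ci * ⟪e (M i) - e 0, e (M j) - e 0⟫ * cj) =
      κ * (c.sum fun i ci => c.sum fun j cj => star ci * (Real.exp ⟪M i, M j⟫ - 1) * cj) := by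
    simp only [Finsupp.sum, Finset.mul_sum]
    refine Finset.sum_congr rfl fun i _ => Finset.sum_congr rfl fun j _ => ?_
    simp only [inner_sub_left, inner_sub_right, he, inner_zero_left, inner_zero_right,
      Real.exp_zero]
    ring
  rw [h2, ← sub_nonneg]
  have h3 := mul_nonneg hκ.le h
  convert h3 using 1
  simp only [Finsupp.sum, Finset.mul_sum, ← Finset.sum_sub_distrib]
  refine Finset.sum_congr rfl fun i _ => Finset.sum_congr rfl fun j _ => ?_
  simp only [Matrix.of_apply]
  ring

theorem norm_linearCombination_comp_le {e : E → X} {κ : ℝ} (hκ : 0 < κ)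
    (he : ∀ a b, ⟪e a, e b⟫ = κ * Real.exp ⟪a, b⟫)
    {M : E →L[ℝ] E} (hM : ‖M‖ ≤ 1) (c : E →₀ ℝ) :
    ‖Finsupp.linearCombination ℝ (fun a => e (M a)) c‖ ≤
      ‖Finsupp.linearCombination ℝ e c‖ := by
  have h := (posSemidef_sub_gram_exp hM le_rfl).2 c
  refine le_of_sq_le_sq ?_ (by positivity)
  rw [← sum_inner_eq_norm_sq, ← sum_inner_eq_norm_sq, ← sub_nonneg]
  have h3 := mul_nonneg hκ.le h
  convert h3 using 1
  simp only [Finsupp.sum, Finset.mul_sum, ← Finset.sum_sub_distrib]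
  refine Finset.sum_congr rfl fun i _ => Finset.sum_congr rfl fun j _ => ?_
  simp only [Matrix.of_apply, he]
  ring

/-- The second quantization `Γ(M)` of a contraction `M`: the contraction that maps each
exponential vector `e a` to `e (M a)`. -/
theorem exists_secondQuantization [CompleteSpace X] {e : E → X} {κ : ℝ} (hκ : 0 < κ)
    (he : ∀ a b, ⟪e a, e b⟫ = κ * Real.exp ⟪a, b⟫)
    (hd : Dense (Submodule.span ℝ (range e) : Set X)) {M : E →L[ℝ] E} (hM : ‖M‖ ≤ 1) :
    ∃ Γ : X →L[ℝ] X, (∀ a, Γ (e a) = e (M a)) ∧ ∀ v, ‖Γ v‖ ≤ ‖v‖ := by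
  have hdr : DenseRange (Finsupp.linearCombination ℝ e) := by
    rw [DenseRange, ← LinearMap.coe_range, Finsupp.range_linearCombination]
    exact hd
  have hle : ∀ c, ‖Finsupp.linearCombination ℝ (fun a => e (M a)) c‖ ≤
      1 * ‖Finsupp.linearCombination ℝ e c‖ := fun c => by
    rw [one_mul]
    exact norm_linearCombination_comp_le hκ he hM c
  refine ⟨(Finsupp.linearCombination ℝ fun a => e (M a)).extendOfNorm
    (Finsupp.linearCombination ℝ e), fun a => ?_, fun v => ?_⟩
  · simpa using LinearMap.extendOfNorm_eq hdr ⟨1, hle⟩ (Finsupp.single a 1)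
  · simpa using LinearMap.norm_extendOfNorm_apply_le hdr 1 hle v

variable {e : E → X} {κ : ℝ} {M : E →L[ℝ] E} {Γ : X →L[ℝ] X}

theorem inner_zero_secondQuantization
    (he : ∀ a b, ⟪e a, e b⟫ = κ * Real.exp ⟪a, b⟫)
    (hd : Dense (Submodule.span ℝ (range e) : Set X)) (hΓ : ∀ a, Γ (e a) = e (M a)) (v : X) :
    ⟪e 0, Γ v⟫ = ⟪e 0, v⟫ := by
  have h : (innerSL ℝ (e 0)) ∘L Γ = innerSL ℝ (e 0) := by
    refine ContinuousLinearMap.ext_on hd ?_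
    rintro _ ⟨a, rfl⟩
    simp [hΓ, he]
  simpa using congrArg (fun L : X →L[ℝ] ℝ => L v) h

theorem norm_secondQuantization_le (hκ : 0 < κ)
    (he : ∀ a b, ⟪e a, e b⟫ = κ * Real.exp ⟪a, b⟫)
    (hd : Dense (Submodule.span ℝ (range e) : Set X)) (hM : ‖M‖ ≤ 1)
    (hΓ : ∀ a, Γ (e a) = e (M a)) {v : X} (hv : ⟪e 0, v⟫ = 0) :
    ‖Γ v‖ ≤ ‖M‖ * ‖v‖ := by
  -- `Q` is the orthogonal projection onto the complement of `e 0`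
  let Q : X →L[ℝ] X := ContinuousLinearMap.id ℝ X - (κ⁻¹ • innerSL ℝ (e 0)).smulRight (e 0)
  have hQe : ∀ a, Q (e a) = e a - e 0 := fun a => by
    simp [Q, he, hκ.ne']
  have key : ∀ w, ‖Γ (Q w)‖ ≤ ‖M‖ * ‖Q w‖ := by
    intro w
    refine hd.induction (P := fun w => ‖Γ (Q w)‖ ≤ ‖M‖ * ‖Q w‖) ?_
      (isClosed_le (by fun_prop) (by fun_prop)) w
    intro w hw
    rw [SetLike.mem_coe, ← Finsupp.range_linearCombination] at hw
    obtain ⟨c, rfl⟩ := hw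
    have h1 : Q (Finsupp.linearCombination ℝ e c) =
        Finsupp.linearCombination ℝ (fun a => e a - e 0) c := by
      simp [Finsupp.linearCombination_apply, Finsupp.sum, map_sum, hQe]
    have h2 : Γ (Finsupp.linearCombination ℝ (fun a => e a - e 0) c) =
        Finsupp.linearCombination ℝ (fun a => e (M a) - e 0) c := by
      simp [Finsupp.linearCombination_apply, Finsupp.sum, map_sum, hΓ]
    rw [h1, h2]
    exact norm_linearCombination_sub_le hκ he le_rfl hM c
  have hQv : Q v = v := by
    simp [Q, hv]
  simpa [hQv] using key v

/-- Since `‖e a - e 0‖² = κ (exp ‖a‖² - 1)`, a bound for `Γ(M)` on the vectors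
`e (√s a) - e 0` becomes a bound for `M a` to first order as `s → 0`. -/
theorem norm_le_of_norm_secondQuantization_le (hκ : 0 < κ)
    (he : ∀ a b, ⟪e a, e b⟫ = κ * Real.exp ⟪a, b⟫)
    (hΓ : ∀ a, Γ (e a) = e (M a)) {N : ℝ} (hN0 : 0 ≤ N)
    (hN : ∀ v, ⟪e 0, v⟫ = 0 → ‖Γ v‖ ≤ N * ‖v‖) : ‖M‖ ≤ N := by
  refine M.opNorm_le_bound hN0 fun a => ?_
  refine le_of_sq_le_sq ?_ (by positivity)
  rw [mul_pow]
  have hns : ∀ a, ‖e a - e 0‖ ^ 2 = κ * (Real.exp (‖a‖ ^ 2) - 1) := fun a => by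
    rw [← real_inner_self_eq_norm_sq]
    simp only [inner_sub_left, inner_sub_right, he, inner_zero_left, inner_zero_right,
      Real.exp_zero, real_inner_self_eq_norm_sq]
    ring
  have hs : ∀ s : ℝ, 0 < s → ‖M a‖ ^ 2 ≤ N ^ 2 * (s⁻¹ * (Real.exp (s * ‖a‖ ^ 2) - 1)) := by
    intro s hs
    have h1 := hN (e (√s • a) - e 0) (by rw [inner_sub_right, he, he]; simp)
    have h2 := pow_le_pow_left₀ (norm_nonneg _) h1 2
    rw [mul_pow, map_sub, hΓ, hΓ, map_zero, hns, hns, map_smul, norm_smul, norm_smul, mul_pow,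
      mul_pow, Real.norm_of_nonneg (Real.sqrt_nonneg s), Real.sq_sqrt hs.le] at h2
    have h3 : Real.exp (s * ‖M a‖ ^ 2) - 1 ≤ N ^ 2 * (Real.exp (s * ‖a‖ ^ 2) - 1) := by
      refine le_of_mul_le_mul_left ?_ hκ
      linarith
    have h4 := Real.add_one_le_exp (s * ‖M a‖ ^ 2)
    have h5 : s * ‖M a‖ ^ 2 ≤ N ^ 2 * (Real.exp (s * ‖a‖ ^ 2) - 1) := by linarith
    calc ‖M a‖ ^ 2 = s⁻¹ * (s * ‖M a‖ ^ 2) := by field_simp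
      _ ≤ s⁻¹ * (N ^ 2 * (Real.exp (s * ‖a‖ ^ 2) - 1)) := by gcongr
      _ = _ := by ring
  have hder : HasDerivAt (fun s : ℝ => Real.exp (s * ‖a‖ ^ 2)) (‖a‖ ^ 2) 0 := by
    simpa using ((hasDerivAt_id (0 : ℝ)).mul_const (‖a‖ ^ 2)).exp
  have hlim := (hder.tendsto_slope_zero_right).const_mul (N ^ 2)
  refine ge_of_tendsto hlim ?_
  filter_upwards [self_mem_nhdsWithin] with s h
  simpa using hs s h

theorem mem_span_singleton_orthogonal_iff {x v : X} :
    v ∈ (Submodule.span ℝ {x})ᗮ ↔ ⟪x, v⟫ = 0 :=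
  Submodule.mem_orthogonal_singleton_iff_inner_right

theorem norm_secondQuantization_comp_subtypeL (hκ : 0 < κ)
    (he : ∀ a b, ⟪e a, e b⟫ = κ * Real.exp ⟪a, b⟫)
    (hd : Dense (Submodule.span ℝ (range e) : Set X)) (hM : ‖M‖ ≤ 1)
    (hΓ : ∀ a, Γ (e a) = e (M a)) :
    ‖Γ ∘L ((Submodule.span ℝ {e 0})ᗮ).subtypeL‖ = ‖M‖ := by
  refine le_antisymm (ContinuousLinearMap.opNorm_le_bound _ (norm_nonneg _) fun v => ?_)
    (norm_le_of_norm_secondQuantization_le hκ he hΓ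
      (Γ ∘L ((Submodule.span ℝ {e 0})ᗮ).subtypeL).opNorm_nonneg fun v hv => ?_)
  · exact norm_secondQuantization_le hκ he hd hM hΓ (mem_span_singleton_orthogonal_iff.1 v.2)
  · exact (Γ ∘L ((Submodule.span ℝ {e 0})ᗮ).subtypeL).le_opNorm
      ⟨v, mem_span_singleton_orthogonal_iff.2 hv⟩

/-- Exponential vectors depend continuously on their parameter. -/
theorem continuous_of_inner_eq_exp (he : ∀ a b, ⟪e a, e b⟫ = κ * Real.exp ⟪a, b⟫) :
    Continuous e := by
  refine continuous_iff_continuousAt.2 fun a => ?_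
  refine tendsto_iff_norm_sub_tendsto_zero.2 ?_
  have h : ∀ b, ‖e b - e a‖ = √(κ * (Real.exp ⟪b, b⟫ - 2 * Real.exp ⟪b, a⟫ +
      Real.exp ⟪a, a⟫)) := fun b => by
    rw [← Real.sqrt_sq (norm_nonneg (e b - e a)), ← real_inner_self_eq_norm_sq]
    simp only [inner_sub_left, inner_sub_right, he, real_inner_comm a b]
    congr 1
    ring
  simp_rw [h]
  have hc : Continuous fun b : E => √(κ * (Real.exp ⟪b, b⟫ - 2 * Real.exp ⟪b, a⟫ +
      Real.exp ⟪a, a⟫)) := by fun_prop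
  convert hc.tendsto a using 2
  ring_nf
  simp

/-- A family of contractions that is strongly continuous on a total set is strongly continuous. -/
theorem continuousOn_apply_of_dense {ι : Type*} {e : ι → X} {G : ℝ → X →L[ℝ] X} {s : Set ℝ}
    (hd : Dense (Submodule.span ℝ (range e) : Set X))
    (hG : ∀ t ∈ s, ∀ v, ‖G t v‖ ≤ ‖v‖) (hc : ∀ a, ContinuousOn (fun t => G t (e a)) s) (v : X) :
    ContinuousOn (fun t => G t v) s := by
  have hspan : ∀ w ∈ Submodule.span ℝ (range e), ContinuousOn (fun t => G t w) s := by
    intro w hw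
    induction hw using Submodule.span_induction with
    | mem x h => obtain ⟨a, rfl⟩ := h; exact hc a
    | zero => simpa using continuousOn_const
    | add x y _ _ hx hy => simpa only [map_add] using! hx.add hy
    | smul r x _ hx => simpa only [map_smul] using! hx.const_smul r
  refine continuousOn_of_uniform_approx_of_continuousOn fun u hu => ?_
  obtain ⟨ε, hε, hεu⟩ := Metric.mem_uniformity_dist.1 hu
  obtain ⟨w, hw, hwv⟩ := Metric.dense_iff.1 hd v ε hε
  refine ⟨fun t => G t w, hspan w hwv, fun t ht => hεu ?_⟩
  rw [dist_eq_norm, ← map_sub]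
  refine (hG t ht _).trans_lt ?_
  rw [← dist_eq_norm, dist_comm]
  exact hw

end SecondQuantization

/-! ### Locally bounded coefficients with countably many discontinuities -/

section TameCoefficients

variable {F : Type*} [NormedAddCommGroup F]

/-- A time-dependent coefficient on `[0,∞)` that is locally bounded and continuous off a countable
set. This is all that is used of piecewise smoothness. -/
structure IsTame (A : ℝ → F) : Prop where
  exists_countable : ∃ s : Set ℝ, s.Countable ∧ ∀ t, 0 < t → t ∉ s → ContinuousAt A t
  exists_bound : ∀ T, ∃ M, ∀ t ∈ Icc 0 T, ‖A t‖ ≤ M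

theorem IsTame.const (v : F) : IsTame fun _ => v :=
  ⟨⟨∅, countable_empty, fun _ _ _ => continuousAt_const⟩, fun _ => ⟨‖v‖, fun _ _ => le_rfl⟩⟩

theorem IsTame.add {A B : ℝ → F} (hA : IsTame A) (hB : IsTame B) :
    IsTame fun t => A t + B t := by
  obtain ⟨s, hs, hAs⟩ := hA.exists_countable
  obtain ⟨u, hu, hBu⟩ := hB.exists_countable
  refine ⟨⟨s ∪ u, hs.union hu, fun t ht h => ?_⟩, fun T => ?_⟩
  · rw [mem_union, not_or] at h
    exact (hAs t ht h.1).add (hBu t ht h.2)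
  · obtain ⟨M, hM⟩ := hA.exists_bound T
    obtain ⟨N, hN⟩ := hB.exists_bound T
    exact ⟨M + N, fun t ht => (norm_add_le _ _).trans (add_le_add (hM t ht) (hN t ht))⟩

theorem IsTame.sum {ι : Type*} (s : Finset ι) {A : ι → ℝ → F} (hA : ∀ i, IsTame (A i)) :
    IsTame fun t => ∑ i ∈ s, A i t := by
  classical
  induction s using Finset.induction_on with
  | empty => simpa using IsTame.const (0 : F)
  | insert i s hi ih => simpa [Finset.sum_insert hi] using (hA i).add ih

theorem IsTame.aestronglyMeasurable {A : ℝ → F} (hA : IsTame A) :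
    AEStronglyMeasurable A (volume.restrict (Ioi 0)) := by
  obtain ⟨s, hs, hAs⟩ := hA.exists_countable
  have h1 : AEStronglyMeasurable A (volume.restrict (Ioi 0 \ s)) := by
    refine ContinuousOn.aestronglyMeasurable (fun t ht => ?_)
      (measurableSet_Ioi.diff hs.measurableSet)
    exact (hAs t ht.1 ht.2).continuousWithinAt
  have h2 : (Ioi (0 : ℝ) \ s : Set ℝ) =ᵐ[volume] Ioi 0 :=
    sdiff_null_ae_eq_self (hs.measure_zero _)
  rwa [Measure.restrict_congr_set h2] at h1

theorem continuousOn_Ici_of_Icc {f : ℝ → F} {s : ℝ} (h : ∀ T, ContinuousOn f (Icc s T)) :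
    ContinuousOn f (Ici s) := by
  intro t ht
  refine (h (t + 1) t ⟨ht, by linarith⟩).mono_of_mem_nhdsWithin ?_
  rw [← Ici_inter_Iic]
  exact inter_mem self_mem_nhdsWithin (mem_nhdsWithin_of_mem_nhds (Iic_mem_nhds (by linarith)))

end TameCoefficients

/-! ### Linear differential equations with discontinuous coefficients -/

section LinearODE

variable {F G : Type*} [NormedAddCommGroup F] [NormedSpace ℝ F]
  [NormedAddCommGroup G] [NormedSpace ℝ G]

theorem IsTame.clm_comp {A : ℝ → F} (hA : IsTame A) (L : F →L[ℝ] G) : IsTame fun t => L (A t) := by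
  obtain ⟨s, hs, hAs⟩ := hA.exists_countable
  refine ⟨⟨s, hs, fun t ht h => L.continuous.continuousAt.comp (hAs t ht h)⟩, fun T => ?_⟩
  obtain ⟨M, hM⟩ := hA.exists_bound T
  exact ⟨‖L‖ * M, fun t ht => L.le_opNorm_of_le (hM t ht)⟩

variable {B : ℝ → F →L[ℝ] G} {x : ℝ → F} {s t : ℝ}

theorem IsTame.aestronglyMeasurable_apply (hB : IsTame B) (hs : 0 ≤ s)
    (hx : ContinuousOn x (Ici s)) :
    AEStronglyMeasurable (fun r => B r (x r)) (volume.restrict (Ioi s)) := by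
  have h1 : AEStronglyMeasurable B (volume.restrict (Ioi s)) :=
    hB.aestronglyMeasurable.mono_measure (Measure.restrict_mono (Ioi_subset_Ioi hs) le_rfl)
  have h2 : AEStronglyMeasurable x (volume.restrict (Ioi s)) :=
    (hx.mono Ioi_subset_Ici_self).aestronglyMeasurable measurableSet_Ioi
  exact (ContinuousLinearMap.apply ℝ G).flip.aestronglyMeasurable_comp₂ h1 h2

theorem IsTame.intervalIntegrable_apply (hB : IsTame B) (hs : 0 ≤ s) (hst : s ≤ t)
    (hx : ContinuousOn x (Ici s)) : IntervalIntegrable (fun r => B r (x r)) volume s t := by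
  obtain ⟨M, hM⟩ := hB.exists_bound t
  obtain ⟨N, hN⟩ := (isCompact_Icc (a := s) (b := t)).exists_bound_of_continuousOn
    (hx.mono Icc_subset_Ici_self)
  rw [intervalIntegrable_iff_integrableOn_Ioc_of_le hst]
  refine IntegrableOn.of_bound (C := M * N) (by simp)
    ((hB.aestronglyMeasurable_apply hs hx).mono_measure
      (Measure.restrict_mono Ioc_subset_Ioi_self le_rfl)) ?_
  refine (ae_restrict_iff' measurableSet_Ioc).2 (ae_of_all _ fun r hr => ?_)
  have hM' := hM r ⟨hs.trans hr.1.le, hr.2⟩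
  exact (B r).le_of_opNorm_le_of_le hM' (hN r (Ioc_subset_Icc_self hr))

theorem continuousOn_primitive_Ici {f : ℝ → F} (h : ∀ t, s ≤ t → IntervalIntegrable f volume s t) :
    ContinuousOn (fun t => ∫ r in s..t, f r) (Ici s) := by
  refine continuousOn_Ici_of_Icc fun T => ?_
  rcases le_or_gt s T with hT | hT
  · have := intervalIntegral.continuousOn_primitive_interval' (h T hT) left_mem_uIcc
    rwa [uIcc_of_le hT] at this
  · simp [Icc_eq_empty_of_lt hT]

/-- `x` solves `x' = B(t) x` on `[s,∞)`, in the time-integrated sense. -/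
def IsCaratheodorySol (B : ℝ → F →L[ℝ] F) (s : ℝ) (x : ℝ → F) : Prop :=
  ContinuousOn x (Ici s) ∧ ∀ t, s ≤ t → x t - x s = ∫ r in s..t, B r (x r)

/-- The bound for the terms of the Dyson series. -/
theorem norm_iterated_integral_le {B : ℝ → F →L[ℝ] F} {u : ℕ → ℝ → F} {T M N : ℝ}
    (hM : ∀ t ∈ Icc s T, ‖B t‖ ≤ M) (hN : ∀ t ∈ Icc s T, ‖u 0 t‖ ≤ N)
    (hu : ∀ n, ∀ t ∈ Icc s T, u (n + 1) t = ∫ r in s..t, B r (u n r)) (n : ℕ) :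
    ∀ t ∈ Icc s T, ‖u n t‖ ≤ N * ((M * (t - s)) ^ n / n.factorial) := by
  induction n with
  | zero => simpa using hN
  | succ n ih =>
    intro t ht
    rw [hu n t ht]
    have h1 : ‖∫ r in s..t, B r (u n r)‖ ≤
        ∫ r in s..t, M * (N * ((M * (r - s)) ^ n / n.factorial)) := by
      refine intervalIntegral.norm_integral_le_of_norm_le ht.1 (ae_of_all _ fun r hr => ?_)
        (Continuous.intervalIntegrable (by fun_prop) _ _)
      have hr' : r ∈ Icc s T := ⟨hr.1.le, hr.2.trans ht.2⟩
      exact (B r).le_of_opNorm_le_of_le (hM r hr') (ih r hr')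
    refine h1.trans_eq ?_
    have h2 : ∀ r, M * (N * ((M * (r - s)) ^ n / n.factorial)) =
        (M ^ (n + 1) * N / n.factorial) * (r - s) ^ n := fun r => by rw [mul_pow]; ring
    simp_rw [h2]
    rw [intervalIntegral.integral_const_mul,
      intervalIntegral.integral_comp_sub_right (fun r => r ^ n) s, integral_pow,
      Nat.factorial_succ, mul_pow]
    push_cast
    have := n.factorial_ne_zero
    field_simp
    simp

theorem IsTame.eq_zero_of_integral_eq {B : ℝ → F →L[ℝ] F} (hB : IsTame B) (hs : 0 ≤ s)
    (hx : ContinuousOn x (Ici s)) (h : ∀ t, s ≤ t → x t = ∫ r in s..t, B r (x r)) (hst : s ≤ t) :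
    x t = 0 := by
  obtain ⟨M, hM⟩ := hB.exists_bound t
  obtain ⟨N, hN⟩ := (isCompact_Icc (a := s) (b := t)).exists_bound_of_continuousOn
    (hx.mono Icc_subset_Ici_self)
  have hM0 : 0 ≤ M := (norm_nonneg _).trans (hM t ⟨hs.trans hst, le_rfl⟩)
  have hle : ∀ n : ℕ, ‖x t‖ ≤ N * ((M * (t - s)) ^ n / n.factorial) := fun n =>
    norm_iterated_integral_le (u := fun _ => x)
      (fun r hr => hM r ⟨hs.trans hr.1, hr.2⟩) hN (fun _ r hr => h r hr.1) n t ⟨hst, le_rfl⟩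
  have hlim := (FloorSemiring.tendsto_pow_div_factorial_atTop (M * (t - s))).const_mul N
  rw [mul_zero] at hlim
  exact norm_le_zero_iff.1 (ge_of_tendsto' hlim hle)

theorem IsTame.caratheodorySol_unique {B : ℝ → F →L[ℝ] F} (hB : IsTame B) (hs : 0 ≤ s)
    {y : ℝ → F} (hx : IsCaratheodorySol B s x) (hy : IsCaratheodorySol B s y) (hxy : x s = y s)
    (hst : s ≤ t) : x t = y t := by
  refine sub_eq_zero.1 (hB.eq_zero_of_integral_eq (x := fun r => x r - y r) hs
    (hx.1.sub hy.1) (fun r hr => ?_) hst)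
  simp only [map_sub]
  rw [intervalIntegral.integral_sub (hB.intervalIntegrable_apply hs hr hx.1)
    (hB.intervalIntegrable_apply hs hr hy.1), ← hx.2 r hr, ← hy.2 r hr, hxy]
  abel

/-- The terms of the Dyson series of `x' = B(t) x`, `x(s) = x₀`. -/
noncomputable def dysonTerm (B : ℝ → F →L[ℝ] F) (s : ℝ) (x₀ : F) : ℕ → ℝ → F
  | 0 => fun _ => x₀
  | n + 1 => fun t => ∫ r in s..t, B r (dysonTerm B s x₀ n r)

theorem IsTame.continuousOn_dysonTerm {B : ℝ → F →L[ℝ] F} (hB : IsTame B) (hs : 0 ≤ s) (x₀ : F)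
    (n : ℕ) : ContinuousOn (dysonTerm B s x₀ n) (Ici s) := by
  induction n with
  | zero => exact continuousOn_const
  | succ n ih =>
    exact continuousOn_primitive_Ici fun t ht => hB.intervalIntegrable_apply hs ht ih

theorem IsTame.exists_caratheodorySol [CompleteSpace F] {B : ℝ → F →L[ℝ] F} (hB : IsTame B)
    (hs : 0 ≤ s) (x₀ : F) : ∃ x, IsCaratheodorySol B s x ∧ x s = x₀ := by
  have hbound : ∀ T, s ≤ T → ∃ M, 0 ≤ M ∧ ∀ n, ∀ t ∈ Icc s T,
      ‖dysonTerm B s x₀ n t‖ ≤ ‖x₀‖ * ((M * (T - s)) ^ n / n.factorial) ∧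
      ‖B t‖ ≤ M := by
    intro T hT
    obtain ⟨M, hM⟩ := hB.exists_bound T
    have hM0 : 0 ≤ M := (norm_nonneg _).trans (hM T ⟨hs.trans hT, le_rfl⟩)
    refine ⟨M, hM0, fun n t ht => ⟨?_, hM t ⟨hs.trans ht.1, ht.2⟩⟩⟩
    refine (norm_iterated_integral_le (u := dysonTerm B s x₀) (N := ‖x₀‖)
      (fun r hr => hM r ⟨hs.trans hr.1, hr.2⟩) (fun _ _ => le_rfl) (fun _ _ _ => rfl) n t
        ht).trans ?_
    have h1 : 0 ≤ t - s := sub_nonneg.2 ht.1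
    have h2 := ht.2
    gcongr
  have hsum : ∀ t, s ≤ t → Summable fun n => dysonTerm B s x₀ n t := by
    intro t ht
    obtain ⟨M, -, hM⟩ := hbound t ht
    exact Summable.of_norm_bounded ((Real.summable_pow_div_factorial _).mul_left _)
      fun n => (hM n t ⟨ht, le_rfl⟩).1
  let x : ℝ → F := fun t => ∑' n, dysonTerm B s x₀ n t
  have hcont : ContinuousOn x (Ici s) := by
    refine continuousOn_Ici_of_Icc fun T => ?_
    rcases le_or_gt s T with hT | hT
    · obtain ⟨M, -, hM⟩ := hbound T hT
      exact continuousOn_tsum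
        (fun n => (hB.continuousOn_dysonTerm hs x₀ n).mono Icc_subset_Ici_self)
        ((Real.summable_pow_div_factorial _).mul_left _) fun n t ht => (hM n t ht).1
    · simp [Icc_eq_empty_of_lt hT]
  have heq : ∀ t, s ≤ t → x t = x₀ + ∫ r in s..t, B r (x r) := by
    intro t ht
    obtain ⟨M, hM0, hM⟩ := hbound t ht
    have h1 : HasSum (fun n => ∫ r in s..t, B r (dysonTerm B s x₀ n r))
        (∫ r in s..t, B r (x r)) := by
      refine intervalIntegral.hasSum_integral_of_dominated_convergence
        (fun n _ => M * (‖x₀‖ * ((M * (t - s)) ^ n / n.factorial))) (fun n => ?_) (fun n => ?_)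
        ?_ ?_ ?_
      · rw [uIoc_of_le ht]
        exact (hB.intervalIntegrable_apply hs ht
          (hB.continuousOn_dysonTerm hs x₀ n)).1.aestronglyMeasurable
      · refine ae_of_all _ fun r hr => ?_
        rw [uIoc_of_le ht] at hr
        obtain ⟨h2, h3⟩ := hM n r ⟨hr.1.le, hr.2⟩
        exact (B r).le_of_opNorm_le_of_le h3 h2
      · exact ae_of_all _ fun r _ =>
          ((Real.summable_pow_div_factorial _).mul_left _).mul_left _
      · exact continuous_const.intervalIntegrable _ _
      · refine ae_of_all _ fun r hr => ?_
        rw [uIoc_of_le ht] at hr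
        exact (B r).hasSum (hsum r hr.1.le).hasSum
    have h2 := (hsum t ht).tsum_eq_zero_add
    rw [← h1.tsum_eq]
    exact h2
  have hxs : x s = x₀ := by simpa using heq s le_rfl
  refine ⟨x, ⟨hcont, fun t ht => ?_⟩, hxs⟩
  rw [heq t ht, hxs, add_sub_cancel_left]

/-- The fundamental solution of `x' = B(t) x`. -/
theorem IsTame.exists_propagator [CompleteSpace F] {B : ℝ → F →L[ℝ] F} (hB : IsTame B)
    (hs : 0 ≤ s) : ∃ U : ℝ → F →L[ℝ] F, U s = ContinuousLinearMap.id ℝ F ∧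
      ContinuousOn U (Ici s) ∧ ∀ v, IsCaratheodorySol B s fun t => U t v := by
  -- the fundamental solution solves the equation in the space of operators
  have hB' : IsTame fun t => ContinuousLinearMap.compL ℝ F F F (B t) := hB.clm_comp _
  obtain ⟨U, hU, hUs⟩ := hB'.exists_caratheodorySol hs (ContinuousLinearMap.id ℝ F)
  refine ⟨U, hUs, hU.1, fun v => ⟨hU.1.clm_apply continuousOn_const, fun t ht => ?_⟩⟩
  have h := congrArg (fun L : F →L[ℝ] F => L v) (hU.2 t ht)
  rw [ContinuousLinearMap.intervalIntegral_apply (hB'.intervalIntegrable_apply hs ht hU.1)] at h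
  simpa using h

theorem IsTame.hasDerivAt_caratheodorySol [CompleteSpace F] {B : ℝ → F →L[ℝ] F} (hB : IsTame B)
    (hs : 0 ≤ s) (hx : IsCaratheodorySol B s x) (hst : s < t) (ht : ContinuousAt B t) :
    HasDerivAt x (B t (x t)) t := by
  have hxt : ContinuousAt x t := hx.1.continuousAt (Ici_mem_nhds hst)
  have h := intervalIntegral.integral_hasDerivAt_right
    (hB.intervalIntegrable_apply hs hst.le hx.1)
    ⟨Ioi s, Ioi_mem_nhds hst, hB.aestronglyMeasurable_apply hs hx.1⟩ (ht.clm_apply hxt)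
  refine (h.const_add (x s)).congr_of_eventuallyEq ?_
  filter_upwards [Ioi_mem_nhds hst] with r hr
  rw [← hx.2 r (le_of_lt hr)]
  abel

end LinearODE

/-- A dissipative equation has contractive solutions: the derivative of `‖x‖ ^ 2`, which exists off
a countable set, is non-positive. -/
theorem IsTame.norm_caratheodorySol_le {E : Type*} [NormedAddCommGroup E] [InnerProductSpace ℝ E]
    [CompleteSpace E] {B : ℝ → E →L[ℝ] E} (hB : IsTame B) {x : ℝ → E} {s t : ℝ} (hs : 0 ≤ s)
    (hx : IsCaratheodorySol B s x) (hdiss : ∀ t, 0 ≤ t → ∀ v, ⟪v, B t v⟫ ≤ 0) (hst : s ≤ t) :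
    ‖x t‖ ≤ ‖x s‖ := by
  obtain ⟨S, hS, hBS⟩ := hB.exists_countable
  have hint : IntervalIntegrable (fun r => 2 * ⟪x r, B r (x r)⟫) volume s t := by
    refine IntervalIntegrable.const_mul ?_ 2
    have h1 := hB.intervalIntegrable_apply hs hst hx.1
    rw [intervalIntegrable_iff_integrableOn_Ioc_of_le hst] at h1 ⊢
    obtain ⟨N, hN⟩ := (isCompact_Icc (a := s) (b := t)).exists_bound_of_continuousOn
      (hx.1.mono Icc_subset_Ici_self)
    refine Integrable.mono' (h1.norm.const_mul N) ?_ ?_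
    · exact ((hx.1.mono fun r hr => hr.1.le).aestronglyMeasurable measurableSet_Ioc).inner
        h1.aestronglyMeasurable
    · refine (ae_restrict_iff' measurableSet_Ioc).2 (ae_of_all _ fun r hr => ?_)
      refine (norm_inner_le_norm _ _).trans ?_
      exact mul_le_mul_of_nonneg_right (hN r (Ioc_subset_Icc_self hr)) (norm_nonneg _)
  have h := integral_eq_of_hasDerivAt_off_countable (fun r => ‖x r‖ ^ 2)
    (fun r => 2 * ⟪x r, B r (x r)⟫) (a := s) (b := t) hS
    (by rw [uIcc_of_le hst]; exact (hx.1.mono Icc_subset_Ici_self).norm.pow 2)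
    (fun r hr => by
      rw [min_eq_left hst, max_eq_right hst] at hr
      exact (hB.hasDerivAt_caratheodorySol hs hx hr.1.1
        (hBS r (hs.trans_lt hr.1.1) hr.2)).norm_sq) hint
  have hneg : ∫ r in s..t, 2 * ⟪x r, B r (x r)⟫ ≤ 0 := by
    rw [← neg_nonneg, ← intervalIntegral.integral_neg]
    refine intervalIntegral.integral_nonneg hst fun r hr => ?_
    have := hdiss r (hs.trans hr.1) (x r)
    linarith
  refine le_of_sq_le_sq ?_ (norm_nonneg _)
  linarith

variable {d : ℕ}

/-! ### The matrix `K` and its square root -/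

section LinearAlgebra

/-- A matrix as an operator on the Euclidean space, linearly in the matrix. -/
noncomputable def mulVecL : Matrix (Fin d) (Fin d) ℝ →ₗ[ℝ] (Space d →L[ℝ] Space d) :=
  (LinearMap.toContinuousLinearMap : (Space d →ₗ[ℝ] Space d) ≃ₗ[ℝ] _).toLinearMap ∘ₗ
    (Matrix.toEuclideanLin : Matrix (Fin d) (Fin d) ℝ ≃ₗ[ℝ] _).toLinearMap

theorem mulVecL_apply (A : Matrix (Fin d) (Fin d) ℝ) (x : Space d) :
    mulVecL A x = mulVecE A x := rfl

theorem mulVecE_apply (A : Matrix (Fin d) (Fin d) ℝ) (x : Space d) (i : Fin d) :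
    mulVecE A x i = ∑ j, A i j * x j := rfl

theorem mulVecE_mul (A B : Matrix (Fin d) (Fin d) ℝ) (x : Space d) :
    mulVecE (A * B) x = mulVecE A (mulVecE B x) := by
  simp [mulVecE]

theorem mulVecE_one (x : Space d) : mulVecE 1 x = x := by
  simp [mulVecE]

theorem mulVecE_add_right (A : Matrix (Fin d) (Fin d) ℝ) (x y : Space d) :
    mulVecE A (x + y) = mulVecE A x + mulVecE A y := map_add (mulVecL A) x y

theorem mulVecE_sub_right (A : Matrix (Fin d) (Fin d) ℝ) (x y : Space d) :
    mulVecE A (x - y) = mulVecE A x - mulVecE A y := map_sub (mulVecL A) x y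

theorem mulVecE_smul_right (A : Matrix (Fin d) (Fin d) ℝ) (c : ℝ) (x : Space d) :
    mulVecE A (c • x) = c • mulVecE A x := map_smul (mulVecL A) c x

theorem mulVecE_zero_right (A : Matrix (Fin d) (Fin d) ℝ) : mulVecE A (0 : Space d) = 0 :=
  map_zero (mulVecL A)

theorem mulVecE_sub_left (A B : Matrix (Fin d) (Fin d) ℝ) (x : Space d) :
    mulVecE (A - B) x = mulVecE A x - mulVecE B x := by
  rw [← mulVecL_apply, map_sub]
  rfl

@[fun_prop]
theorem continuous_mulVecE (A : Matrix (Fin d) (Fin d) ℝ) :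
    Continuous (fun x : Space d => mulVecE A x) :=
  (mulVecL A).continuous

theorem contDiff_mulVecE (A : Matrix (Fin d) (Fin d) ℝ) :
    ContDiff ℝ ∞ (fun x : Space d => mulVecE A x) :=
  (mulVecL A).contDiff

theorem inner_mulVecE_comm {A : Matrix (Fin d) (Fin d) ℝ} (hA : A.IsHermitian) (x y : Space d) :
    ⟪x, mulVecE A y⟫ = ⟪mulVecE A x, y⟫ := by
  have h := Matrix.toEuclideanLin_conjTranspose_eq_adjoint A
  rw [hA.eq] at h
  rw [mulVecE, mulVecE]
  nth_rw 1 [h]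
  exact LinearMap.adjoint_inner_right _ _ _

theorem inner_mulVecE_nonneg {A : Matrix (Fin d) (Fin d) ℝ} (hA : A.PosSemidef) (x : Space d) :
    0 ≤ ⟪x, mulVecE A x⟫ := by
  have h := hA.dotProduct_mulVec_nonneg x.ofLp
  have h2 := Matrix.inner_toEuclideanCLM A x x
  simp only [star_trivial] at h
  rw [← h2] at h
  exact h

variable {K : Matrix (Fin d) (Fin d) ℝ}

open scoped MatrixOrder in
theorem sqrt_mul_sqrt (hK : K.PosDef) : CFC.sqrt K * CFC.sqrt K = K :=
  CFC.sqrt_mul_sqrt_self K (Matrix.nonneg_iff_posSemidef.2 hK.posSemidef)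

open scoped MatrixOrder in
theorem isHermitian_sqrt (K : Matrix (Fin d) (Fin d) ℝ) : (CFC.sqrt K).IsHermitian :=
  (Matrix.nonneg_iff_posSemidef.1 (CFC.sqrt_nonneg K)).isHermitian

open scoped MatrixOrder in
theorem isUnit_det_sqrt (hK : K.PosDef) : IsUnit (CFC.sqrt K).det := by
  have h := hK.det_pos.ne'
  rw [← sqrt_mul_sqrt hK, Matrix.det_mul] at h
  exact (left_ne_zero_of_mul h).isUnit

/-- `K^{1/2}` as an operator on the Euclidean space. -/
noncomputable def sqrtL (K : Matrix (Fin d) (Fin d) ℝ) : Space d →L[ℝ] Space d :=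
  open scoped MatrixOrder in mulVecL (CFC.sqrt K)

open scoped MatrixOrder in
theorem sqrtL_apply (K : Matrix (Fin d) (Fin d) ℝ) (x : Space d) :
    sqrtL K x = mulVecE (CFC.sqrt K) x := rfl

open scoped MatrixOrder in
theorem sqrtL_surjective (hK : K.PosDef) : Function.Surjective (sqrtL K) := fun y =>
  ⟨mulVecE (CFC.sqrt K)⁻¹ y, by
    rw [sqrtL_apply, ← mulVecE_mul, Matrix.mul_nonsing_inv _ (isUnit_det_sqrt hK), mulVecE_one]⟩

open scoped MatrixOrder in
/-- `K^{1/2}` is an isometry from the Euclidean norm to the norm given by `K⁻¹`. -/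
theorem inner_sqrtL (hK : K.PosDef) (a b : Space d) :
    ⟪sqrtL K a, mulVecE K⁻¹ (sqrtL K b)⟫ = ⟪a, b⟫ := by
  have hu := isUnit_det_sqrt hK
  rw [sqrtL_apply, sqrtL_apply, ← inner_mulVecE_comm (isHermitian_sqrt K), ← mulVecE_mul,
    ← mulVecE_mul]
  have h : CFC.sqrt K * (K⁻¹ * CFC.sqrt K) = 1 := by
    conv_lhs => rw [← sqrt_mul_sqrt hK]
    rw [Matrix.mul_inv_rev]
    simp only [sqrt_mul_sqrt hK]
    rw [Matrix.mul_assoc, Matrix.nonsing_inv_mul _ hu, Matrix.mul_one, Matrix.mul_nonsing_inv _ hu]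
  rw [Matrix.mul_assoc, h, mulVecE_one]

open scoped MatrixOrder in
theorem sqrtL_conjSqrt (hK : K.PosDef) (C : Matrix (Fin d) (Fin d) ℝ) (a : Space d) :
    sqrtL K (mulVecE (conjSqrt K C) a) = mulVecE C (sqrtL K a) := by
  rw [sqrtL_apply, sqrtL_apply, ← mulVecE_mul, ← mulVecE_mul, conjSqrt, Matrix.mul_assoc,
    Matrix.mul_nonsing_inv_cancel_left _ _ (isUnit_det_sqrt hK)]

theorem exists_le_inner_inv (hK : K.PosDef) :
    ∃ δ > 0, ∀ x : Space d, δ * ‖x‖ ^ 2 ≤ ⟪x, mulVecE K⁻¹ x⟫ := by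
  refine ⟨((‖sqrtL K‖ + 1) ^ 2)⁻¹, by positivity, fun x => ?_⟩
  obtain ⟨a, rfl⟩ := sqrtL_surjective hK x
  rw [inner_sqrtL hK, real_inner_self_eq_norm_sq, inv_mul_le_iff₀ (by positivity), ← mul_pow]
  have h1 := (sqrtL K).le_opNorm a
  have h2 := norm_nonneg a
  gcongr
  linarith

end LinearAlgebra

/-! ### Translated Gaussian densities -/

section Gaussian

variable {K : Matrix (Fin d) (Fin d) ℝ}

theorem fInf_pos (hK : K.PosDef) (x : Space d) : 0 < fInf K x := by
  have := hK.det_pos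
  unfold fInf
  positivity

theorem contDiff_fInf (K : Matrix (Fin d) (Fin d) ℝ) : ContDiff ℝ ∞ (fInf K) := by
  unfold fInf
  have h : ContDiff ℝ ∞ fun x : Space d => ⟪x, mulVecE K⁻¹ x⟫ :=
    contDiff_id.inner ℝ (contDiff_mulVecE K⁻¹)
  fun_prop

@[fun_prop]
theorem continuous_fInf (K : Matrix (Fin d) (Fin d) ℝ) : Continuous (fInf K) :=
  (contDiff_fInf K).continuous

theorem fInf_neg (K : Matrix (Fin d) (Fin d) ℝ) (x : Space d) : fInf K (-x) = fInf K x := by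
  have : mulVecE K⁻¹ (-x) = -mulVecE K⁻¹ x := map_neg (mulVecL K⁻¹) x
  simp [fInf, this]

theorem fInf_sub (hK : K.PosDef) (x m : Space d) :
    fInf K (x - m) =
      fInf K x * Real.exp (⟪m, mulVecE K⁻¹ x⟫ - ⟪m, mulVecE K⁻¹ m⟫ / 2) := by
  have h : ⟪x, mulVecE K⁻¹ m⟫ = ⟪m, mulVecE K⁻¹ x⟫ := by
    rw [inner_mulVecE_comm hK.inv.isHermitian, real_inner_comm]
  rw [fInf, fInf, mul_assoc, ← Real.exp_add]
  congr 2
  simp only [mulVecE_sub_right, inner_sub_left, inner_sub_right, h]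
  ring

theorem fInf_sub_mul_fInf_sub (hK : K.PosDef) (x m n : Space d) :
    fInf K (x - m) * fInf K (x - n) * (fInf K x)⁻¹ =
      Real.exp ⟪m, mulVecE K⁻¹ n⟫ * fInf K (x - (m + n)) := by
  have h : ⟪n, mulVecE K⁻¹ m⟫ = ⟪m, mulVecE K⁻¹ n⟫ := by
    rw [inner_mulVecE_comm hK.inv.isHermitian, real_inner_comm]
  have h0 := (fInf_pos hK x).ne'
  rw [fInf_sub hK x m, fInf_sub hK x n, fInf_sub hK x (m + n)]
  have h1 : ∀ a b : ℝ, fInf K x * Real.exp a * (fInf K x * Real.exp b) * (fInf K x)⁻¹ =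
      fInf K x * Real.exp (a + b) := fun a b => by
    rw [Real.exp_add]
    field_simp
  rw [h1, mul_left_comm, ← Real.exp_add]
  congr 2
  simp only [mulVecE_add_right, inner_add_left, inner_add_right, h]
  ring

theorem integrable_fInf (hK : K.PosDef) : Integrable (fInf K) := by
  obtain ⟨δ, hδ, h⟩ := exists_le_inner_inv hK
  have h1 : Integrable fun x : Space d => Real.exp (-(δ / 2) * ‖x‖ ^ 2) := by
    have := (GaussianFourier.integrable_cexp_neg_mul_sq_norm_add (b := ((δ / 2 : ℝ) : ℂ))
      (by simpa using hδ) 0 (0 : Space d)).norm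
    refine this.congr (ae_of_all _ fun x => ?_)
    simp only [Complex.norm_exp]
    simp
    left
    norm_cast
  refine Integrable.mono' (h1.const_mul (K.det ^ (-(1 / 2) : ℝ) / (2 * Real.pi) ^ ((d : ℝ) / 2)))
    (continuous_fInf K).aestronglyMeasurable (ae_of_all _ fun x => ?_)
  rw [Real.norm_of_nonneg (fInf_pos hK x).le, fInf]
  have := hK.det_pos
  gcongr
  linarith [h x]

theorem integral_fInf_pos (hK : K.PosDef) : 0 < ∫ x, fInf K x := by
  rw [integral_pos_iff_support_of_nonneg (fun x => (fInf_pos hK x).le) (integrable_fInf hK)]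
  have : Function.support (fInf K) = univ :=
    eq_univ_of_forall fun x => (fInf_pos hK x).ne'
  rw [this]
  exact Measure.measure_univ_pos.2 (NeZero.ne _)

theorem measurable_density (K : Matrix (Fin d) (Fin d) ℝ) :
    Measurable fun x => ENNReal.ofReal (fInf K x)⁻¹ :=
  (continuous_fInf K).measurable.inv.ennreal_ofReal

theorem weight_absolutelyContinuous (K : Matrix (Fin d) (Fin d) ℝ) : weight K ≪ volume :=
  withDensity_absolutelyContinuous _ _

theorem absolutelyContinuous_weight (hK : K.PosDef) : volume ≪ weight K :=
  withDensity_absolutelyContinuous' (measurable_density K).aemeasurable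
    (ae_of_all _ fun x => by simpa using fInf_pos hK x)

theorem integrable_weight_iff (hK : K.PosDef) {u : Space d → ℝ} :
    Integrable u (weight K) ↔ Integrable fun x => u x * (fInf K x)⁻¹ := by
  rw [weight, integrable_withDensity_iff (measurable_density K) (ae_of_all _ fun x => by simp)]
  simp only [ENNReal.toReal_ofReal (inv_nonneg.2 (fInf_pos hK _).le)]

theorem integral_weight (hK : K.PosDef) (u : Space d → ℝ) :
    ∫ x, u x ∂weight K = ∫ x, u x * (fInf K x)⁻¹ := by
  rw [weight, integral_withDensity_eq_integral_toReal_smul (measurable_density K)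
    (ae_of_all _ fun x => by simp)]
  simp only [ENNReal.toReal_ofReal (inv_nonneg.2 (fInf_pos hK _).le), smul_eq_mul, mul_comm]

theorem inner_H (hK : K.PosDef) (u v : H K) : ⟪u, v⟫ = ∫ x, u x * v x * (fInf K x)⁻¹ := by
  rw [L2.inner_def, integral_weight hK]
  simp [mul_comm]

theorem integrable_mul_mul_inv (hK : K.PosDef) (u v : H K) :
    Integrable fun x => u x * v x * (fInf K x)⁻¹ := by
  rw [← integrable_weight_iff hK]
  exact (Lp.memLp u).integrable_mul (Lp.memLp v)

theorem memLp_fInf_sub (hK : K.PosDef) (m : Space d) :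
    MemLp (fun x => fInf K (x - m)) 2 (weight K) := by
  rw [memLp_two_iff_integrable_sq (by fun_prop), integrable_weight_iff hK]
  simp only [sq, fInf_sub_mul_fInf_sub hK]
  exact ((integrable_fInf hK).comp_sub_right _).const_mul _

/-- The exponential vectors of `H`: the Gaussian densities with covariance `K` and mean
`K^{1/2} a`. -/
noncomputable def expVec (hK : K.PosDef) (a : Space d) : H K :=
  (memLp_fInf_sub hK (sqrtL K a)).toLp

theorem coeFn_expVec (hK : K.PosDef) (a : Space d) :
    expVec hK a =ᵐ[volume] fun x => fInf K (x - sqrtL K a) :=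
  (absolutelyContinuous_weight hK).ae_le (memLp_fInf_sub hK (sqrtL K a)).coeFn_toLp

theorem inner_expVec (hK : K.PosDef) (a b : Space d) :
    ⟪expVec hK a, expVec hK b⟫ = (∫ x, fInf K x) * Real.exp ⟪a, b⟫ := by
  rw [inner_H hK, integral_congr_ae (g := fun x => Real.exp ⟪a, b⟫ *
    fInf K (x - (sqrtL K a + sqrtL K b))), integral_const_mul,
    integral_sub_right_eq_self (fInf K), mul_comm]
  filter_upwards [coeFn_expVec hK a, coeFn_expVec hK b] with x h1 h2
  rw [h1, h2, fInf_sub_mul_fInf_sub hK, inner_sqrtL hK]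

theorem V0_eq (hK : K.PosDef) : V0 K = Submodule.span ℝ {expVec hK 0} := by
  rw [V0]
  congr 1
  ext g
  have h : expVec hK 0 =ᵐ[weight K] fInf K := by
    have := (memLp_fInf_sub hK (sqrtL K 0)).coeFn_toLp
    simp only [map_zero, sub_zero] at this
    unfold expVec
    simpa only [map_zero, sub_zero] using this
  constructor
  · intro hg
    exact Lp.ext (EventuallyEq.trans (mem_ofPred.1 hg) h.symm)
  · rintro rfl
    exact h

end Gaussian

/-! ### Totality of the exponential vectors -/

section Totality

theorem integrable_exp_withDensity_ofReal {V : Type*} [MeasurableSpace V] {μ : Measure V}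
    {g X : V → ℝ} (hg : Measurable g) (hi : Integrable (fun x => Real.exp (X x) * g x) μ) :
    Integrable (fun x => Real.exp (X x)) (μ.withDensity fun x => ENNReal.ofReal (g x)) := by
  rw [integrable_withDensity_iff hg.ennreal_ofReal (ae_of_all _ fun x => by simp)]
  refine hi.pos_part.congr (ae_of_all _ fun x => ?_)
  simp only [ENNReal.toReal_ofReal']
  rw [mul_max_of_nonneg _ _ (Real.exp_pos _).le, mul_zero]

theorem integral_exp_withDensity_ofReal {V : Type*} [MeasurableSpace V] {μ : Measure V}
    {g X : V → ℝ} (hg : Measurable g) :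
    ∫ x, Real.exp (X x) ∂(μ.withDensity fun x => ENNReal.ofReal (g x)) =
      ∫ x, max (Real.exp (X x) * g x) 0 ∂μ := by
  rw [integral_withDensity_eq_integral_toReal_smul hg.ennreal_ofReal
    (ae_of_all _ fun x => by simp)]
  refine integral_congr_ae (ae_of_all _ fun x => ?_)
  simp only [ENNReal.toReal_ofReal', smul_eq_mul]
  rw [mul_comm, mul_max_of_nonneg _ _ (Real.exp_pos _).le, mul_zero]

/-- A function whose two-sided Laplace transform exists and vanishes everywhere is zero: its
positive and negative parts are densities of measures with the same moment generating functions,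
hence, by analytic continuation, with the same characteristic function. -/
theorem ae_eq_zero_of_integral_exp_inner_mul {V : Type*} [NormedAddCommGroup V]
    [InnerProductSpace ℝ V] [FiniteDimensional ℝ V] [MeasurableSpace V] [BorelSpace V]
    {μ : Measure V} {g : V → ℝ} (hg : Measurable g)
    (hi : ∀ y, Integrable (fun x => Real.exp ⟪x, y⟫ * g x) μ)
    (h0 : ∀ y, ∫ x, Real.exp ⟪x, y⟫ * g x ∂μ = 0) : g =ᵐ[μ] 0 := by
  have hgi : Integrable g μ := by simpa using hi 0
  set μp := μ.withDensity fun x => ENNReal.ofReal (g x) with hμp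
  set μn := μ.withDensity fun x => ENNReal.ofReal (-g x) with hμn
  have hfin : ∀ f : V → ℝ, Integrable f μ → ∫⁻ x, ENNReal.ofReal (f x) ∂μ ≠ ⊤ := fun f hf =>
    ((lintegral_mono fun x => Real.ofReal_le_enorm (f x)).trans_lt hf.2).ne
  have : IsFiniteMeasure μp := isFiniteMeasure_withDensity (hfin g hgi)
  have : IsFiniteMeasure μn := isFiniteMeasure_withDensity (hfin _ hgi.neg)
  have hmgf : ∀ y, ∫ x, Real.exp ⟪x, y⟫ ∂μp = ∫ x, Real.exp ⟪x, y⟫ ∂μn := by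
    intro y
    rw [hμp, hμn, integral_exp_withDensity_ofReal hg,
      integral_exp_withDensity_ofReal (g := fun x => -g x) hg.neg,
      ← sub_eq_zero, ← integral_sub (hi y).pos_part]
    · refine Eq.trans ?_ (h0 y)
      refine integral_congr_ae (ae_of_all _ fun x => ?_)
      simp only [mul_neg]
      exact posPart_sub_negPart (Real.exp ⟪x, y⟫ * g x)
    · refine (hi y).neg_part.congr (ae_of_all _ fun x => ?_)
      simp
  have hchar : charFun μp = charFun μn := by
    ext y
    have hexp : ProbabilityTheory.integrableExpSet (fun x => ⟪x, y⟫) μp = univ := by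
      refine eq_univ_of_forall fun t => ?_
      refine integrable_exp_withDensity_ofReal (X := fun x => t * ⟪x, y⟫) hg ?_
      simpa [inner_smul_right] using hi (t • y)
    have hm : ProbabilityTheory.mgf (fun x => ⟪x, y⟫) μp =
        ProbabilityTheory.mgf (fun x => ⟪x, y⟫) μn := by
      funext t
      simpa [ProbabilityTheory.mgf, inner_smul_right] using hmgf (t • y)
    have hz : μp = 0 ↔ μn = 0 := by
      have h1 := hmgf 0
      simp only [inner_zero_right, Real.exp_zero, integral_const, smul_eq_mul, mul_one] at h1
      rw [← Measure.measure_univ_eq_zero, ← Measure.measure_univ_eq_zero,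
        ← measureReal_eq_zero_iff, ← measureReal_eq_zero_iff, h1]
    have h2 := ProbabilityTheory.eqOn_complexMGF_of_mgf' hm hz
      (show Complex.I ∈ _ by simp [hexp])
    simpa [ProbabilityTheory.complexMGF, charFun_apply, mul_comm] using h2
  have heq : μp = μn := Measure.ext_of_charFun hchar
  have hae := (withDensity_eq_iff hg.ennreal_ofReal.aemeasurable
    hg.neg.ennreal_ofReal.aemeasurable (hfin g hgi)).1 heq
  filter_upwards [hae] with x hx
  have h3 := congrArg ENNReal.toReal hx
  simp only [ENNReal.toReal_ofReal'] at h3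
  have h4 : max (g x) 0 - max (-g x) 0 = g x := posPart_sub_negPart (g x)
  rw [Pi.neg_apply] at h3
  rw [Pi.zero_apply, ← h4, h3, sub_self]

/-- The exponential vectors are total in `H`. -/
theorem dense_span_expVec {K : Matrix (Fin d) (Fin d) ℝ} (hK : K.PosDef) :
    Dense (Submodule.span ℝ (range (expVec hK)) : Set (H K)) := by
  rw [Submodule.dense_iff_topologicalClosure_eq_top, Submodule.topologicalClosure_eq_top_iff,
    Submodule.eq_bot_iff]
  intro g hg
  -- the mean `K y` turns the quotient of the densities into a multiple of `exp ⟪x, y⟫`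
  have key : ∀ y, ∃ a : Space d, ∃ κ : ℝ, κ ≠ 0 ∧
      (fun x => expVec hK a x * g x * (fInf K x)⁻¹) =ᵐ[volume]
        fun x => κ * (Real.exp ⟪x, y⟫ * g x) := by
    intro y
    obtain ⟨a, ha⟩ := sqrtL_surjective hK (mulVecE K y)
    refine ⟨a, Real.exp (-(⟪mulVecE K y, mulVecE K⁻¹ (mulVecE K y)⟫ / 2)), (Real.exp_pos _).ne',
      ?_⟩
    filter_upwards [coeFn_expVec hK a] with x hx
    have h0 := (fInf_pos hK x).ne'
    rw [hx, ha, fInf_sub hK, inner_mulVecE_comm hK.inv.isHermitian (mulVecE K y) x,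
      ← mulVecE_mul K⁻¹ K y, Matrix.nonsing_inv_mul _ hK.det_pos.ne'.isUnit, mulVecE_one,
      real_inner_comm, sub_eq_add_neg, Real.exp_add]
    field_simp
  have hzero : (g : Space d → ℝ) =ᵐ[volume] 0 := by
    refine ae_eq_zero_of_integral_exp_inner_mul (Lp.stronglyMeasurable g).measurable
      (fun y => ?_) (fun y => ?_)
    · obtain ⟨a, κ, hκ, h⟩ := key y
      exact (integrable_const_mul_iff hκ.isUnit _).1
        ((integrable_mul_mul_inv hK (expVec hK a) g).congr h)
    · obtain ⟨a, κ, hκ, h⟩ := key y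
      have h1 : ⟪expVec hK a, g⟫ = 0 :=
        (Submodule.mem_orthogonal _ _).1 hg _ (Submodule.subset_span (mem_range_self a))
      rw [inner_H hK, integral_congr_ae h, integral_const_mul] at h1
      exact (mul_eq_zero.1 h1).resolve_left hκ
  have hzero' : (g : Space d → ℝ) =ᵐ[weight K] 0 := (weight_absolutelyContinuous K).ae_le hzero
  exact Lp.ext (hzero'.trans (Lp.coeFn_zero _ _ _).symm)

end Totality

/-! ### Pairing with test functions -/

section LebesguePairing

variable {K : Matrix (Fin d) (Fin d) ℝ}

/-- The unweighted pairing of `H` with a test function is a bounded functional. -/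
theorem exists_lebesguePairing (hK : K.PosDef) {ψ : Space d → ℝ} (hψ : Continuous ψ)
    (hc : HasCompactSupport ψ) :
    ∃ Λ : H K →L[ℝ] ℝ, ∀ g : H K, Integrable (fun x => g x * ψ x) ∧ Λ g = ∫ x, g x * ψ x := by
  have hmem : MemLp (fun x => fInf K x * ψ x) 2 (weight K) := by
    rw [memLp_two_iff_integrable_sq (by fun_prop), integrable_weight_iff hK]
    have h : (fun x => (fInf K x * ψ x) ^ 2 * (fInf K x)⁻¹) =
        fun x => (fInf K x * ψ x) * ψ x := by
      funext x
      have := (fInf_pos hK x).ne'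
      field_simp
    rw [h]
    exact Continuous.integrable_of_hasCompactSupport (by fun_prop) hc.mul_left
  have hae : ∀ g : H K, (fun x => (hmem.toLp : H K) x * g x * (fInf K x)⁻¹) =ᵐ[volume]
      fun x => g x * ψ x := by
    intro g
    filter_upwards [(absolutelyContinuous_weight hK).ae_le hmem.coeFn_toLp] with x hx
    have := (fInf_pos hK x).ne'
    rw [hx]
    field_simp
  refine ⟨innerSL ℝ (hmem.toLp : H K), fun g => ⟨(integrable_mul_mul_inv hK _ g).congr (hae g), ?_⟩⟩
  rw [innerSL_apply_apply, inner_H hK, integral_congr_ae (hae g)]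

end LebesguePairing

/-! ### The divergence theorem for compactly supported fields -/

section Divergence

theorem inner_gradient {u : Space d → ℝ} (x v : Space d) :
    ⟪gradient u x, v⟫ = fderiv ℝ u x v := by
  simp [gradient]

theorem contDiff_gradient {u : Space d → ℝ} (hu : ContDiff ℝ ∞ u) : ContDiff ℝ ∞ (gradient u) :=
  (InnerProductSpace.toDual ℝ (Space d)).symm.toContinuousLinearEquiv.contDiff.comp
    (hu.fderiv_right (m := ∞) (by simp))

theorem hasCompactSupport_gradient {u : Space d → ℝ} (hu : HasCompactSupport u) :
    HasCompactSupport (gradient u) :=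
  (hu.fderiv ℝ).comp_left (g := (InnerProductSpace.toDual ℝ (Space d)).symm) (map_zero _)

theorem sum_smul_single (x : Space d) : ∑ i, x i • EuclideanSpace.single i (1 : ℝ) = x := by
  ext j
  simp [Finset.sum_apply, Pi.single_apply]

theorem divergence_smul {u : Space d → ℝ} {W : Space d → Space d} {x : Space d}
    (hu : DifferentiableAt ℝ u x) (hW : DifferentiableAt ℝ W x) :
    divergence (fun y => u y • W y) x = ⟪gradient u x, W x⟫ + u x * divergence W x := by
  have h : ⟪gradient u x, W x⟫ = ∑ i, fderiv ℝ u x (EuclideanSpace.single i 1) * W x i := by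
    rw [inner_gradient]
    conv_lhs => rw [← sum_smul_single (W x)]
    simp [map_sum, mul_comm]
  rw [divergence, fderiv_fun_smul hu hW, h, divergence, Finset.mul_sum,
    ← Finset.sum_add_distrib]
  refine Finset.sum_congr rfl fun i _ => ?_
  simp
  ring

theorem divergence_sub {V W : Space d → Space d} {x : Space d}
    (hV : DifferentiableAt ℝ V x) (hW : DifferentiableAt ℝ W x) :
    divergence (fun y => V y - W y) x = divergence V x - divergence W x := by
  simp [divergence, fderiv_fun_sub hV hW]

theorem divergence_mulVecE_comp (A : Matrix (Fin d) (Fin d) ℝ) {W : Space d → Space d}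
    {x : Space d} (hW : DifferentiableAt ℝ W x) :
    divergence (fun y => mulVecE A (W y)) x =
      ∑ i, ∑ j, A i j * (fderiv ℝ W x (EuclideanSpace.single i 1)) j := by
  have h : fderiv ℝ (fun y => mulVecE A (W y)) x = (mulVecL A) ∘L fderiv ℝ W x :=
    ((mulVecL A).hasFDerivAt.comp x hW.hasFDerivAt).fderiv
  simp [divergence, h, mulVecL_apply, mulVecE_apply]

theorem divergence_mulVecE_sub (A : Matrix (Fin d) (Fin d) ℝ) (m x : Space d) :
    divergence (fun y => mulVecE A (y - m)) x = A.trace := by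
  rw [divergence_mulVecE_comp A (by fun_prop)]
  simp [fderiv_sub_const, Matrix.trace]

theorem integral_divergence_eq_zero {Z : Space d → Space d} (hZ : ContDiff ℝ 1 Z)
    (hc : HasCompactSupport Z) : ∫ x, divergence Z x = 0 := by
  have hZi : ∀ i, ContDiff ℝ 1 fun x => Z x i := fun i =>
    (EuclideanSpace.proj (𝕜 := ℝ) i).contDiff.comp hZ
  have hci : ∀ i, HasCompactSupport fun x => Z x i := fun i =>
    hc.comp_left (g := fun v : Space d => v i) rfl
  have hfd : ∀ i x, (fderiv ℝ Z x (EuclideanSpace.single i 1)) i =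
      fderiv ℝ (fun x => Z x i) x (EuclideanSpace.single i 1) := by
    intro i x
    have h : fderiv ℝ (fun x => Z x i) x = (EuclideanSpace.proj (𝕜 := ℝ) i) ∘L fderiv ℝ Z x :=
      ((EuclideanSpace.proj (𝕜 := ℝ) i).hasFDerivAt.comp x
        (hZ.differentiable one_ne_zero x).hasFDerivAt).fderiv
    rw [h]
    rfl
  have hint : ∀ i, Integrable fun x =>
      fderiv ℝ (fun x => Z x i) x (EuclideanSpace.single i (1 : ℝ)) := fun i =>
    Continuous.integrable_of_hasCompactSupport
      (((hZi i).continuous_fderiv one_ne_zero).clm_apply continuous_const)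
      ((hci i).fderiv_apply ℝ _)
  simp only [divergence, hfd]
  rw [integral_finsetSum _ fun i _ => hint i]
  refine Finset.sum_eq_zero fun i _ => ?_
  have h := integral_mul_fderiv_eq_neg_fderiv_mul_of_integrable (μ := (volume : Measure (Space d)))
    (f := fun _ => (1 : ℝ)) (g := fun x => Z x i) (v := EuclideanSpace.single i (1 : ℝ))
    (by simp) (by simpa using hint i)
    (by simpa using (hZi i).continuous.integrable_of_hasCompactSupport (hci i))
    (fun _ _ => differentiableAt_const _) (fun x _ => (hZi i).differentiable one_ne_zero x)
  simpa using h

end Divergence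

/-! ### Consequences of stationarity -/

section Stationarity

variable {K C D : Matrix (Fin d) (Fin d) ℝ}

theorem gradient_fInf (hK : K.PosDef) (x : Space d) :
    gradient (fInf K) x = -(fInf K x) • mulVecE K⁻¹ x := by
  have h1 : HasFDerivAt (fun y : Space d => ⟪y, mulVecE K⁻¹ y⟫)
      ((fderivInnerCLM ℝ (x, mulVecE K⁻¹ x)).comp
        ((ContinuousLinearMap.id ℝ (Space d)).prod (mulVecL K⁻¹))) x :=
    (hasFDerivAt_id x).inner ℝ (mulVecL K⁻¹).hasFDerivAt
  have h2 := ((h1.const_mul (1 / 2)).neg.exp).const_mul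
    (K.det ^ (-(1 / 2) : ℝ) / (2 * Real.pi) ^ ((d : ℝ) / 2))
  have h3 : fInf K = fun y => K.det ^ (-(1 / 2) : ℝ) / (2 * Real.pi) ^ ((d : ℝ) / 2) *
      Real.exp (-(1 / 2 * ⟪y, mulVecE K⁻¹ y⟫)) := by
    funext y
    rw [fInf, one_div_mul_eq_div]
  rw [show ((fun y => K.det ^ (-(1 / 2) : ℝ) / (2 * Real.pi) ^ ((d : ℝ) / 2) *
    Real.exp ((-fun y : Space d => 1 / 2 * ⟪y, mulVecE K⁻¹ y⟫) y)) : Space d → ℝ) = fInf K from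
    h3.symm] at h2
  refine ext_inner_right ℝ fun v => ?_
  rw [inner_gradient, h2.fderiv]
  simp only [h3]
  have h4 : ⟪x, mulVecE K⁻¹ v⟫ = ⟪mulVecE K⁻¹ x, v⟫ := inner_mulVecE_comm hK.inv.isHermitian x v
  have h5 : ⟪v, mulVecE K⁻¹ x⟫ = ⟪mulVecE K⁻¹ x, v⟫ := real_inner_comm _ _
  simp [mulVecL_apply, h4, h5, real_inner_smul_left]
  ring

/-- Stationarity of the Gaussian says that the drift `C - D K⁻¹` is divergence free and tangential
to the level sets of `x ↦ ⟪x, K⁻¹ x⟫`. -/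
theorem trace_eq_zero_and_inner_eq_zero (hK : K.PosDef) (h : ∀ x, negL C D (fInf K) x = 0) :
    (C - D * K⁻¹).trace = 0 ∧
      ∀ x : Space d, ⟪mulVecE K⁻¹ x, mulVecE (C - D * K⁻¹) x⟫ = 0 := by
  have h1 : ∀ x, negL C D (fInf K) x = fInf K x *
      ((C - D * K⁻¹).trace - ⟪mulVecE K⁻¹ x, mulVecE (C - D * K⁻¹) x⟫) := by
    intro x
    have h2 : (fun y => mulVecE D (gradient (fInf K) y) + fInf K y • mulVecE C y) =
        fun y => fInf K y • mulVecE (C - D * K⁻¹) (y - 0) := by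
      funext y
      rw [gradient_fInf hK, mulVecE_smul_right, sub_zero, mulVecE_sub_left, mulVecE_mul]
      module
    have h3 : ContDiff ℝ ∞ fun y : Space d => mulVecE (C - D * K⁻¹) (y - 0) :=
      (contDiff_mulVecE _).comp (by fun_prop)
    rw [negL, h2, divergence_smul ((contDiff_fInf K).differentiable (by simp) x)
      (h3.differentiable (by simp) x),
      divergence_mulVecE_sub, gradient_fInf hK, real_inner_smul_left, sub_zero]
    ring
  have h4 : ∀ x : Space d,
      (C - D * K⁻¹).trace - ⟪mulVecE K⁻¹ x, mulVecE (C - D * K⁻¹) x⟫ = 0 := fun x =>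
    (mul_eq_zero.1 ((h1 x).symm.trans (h x))).resolve_left (fInf_pos hK x).ne'
  have h5 : (C - D * K⁻¹).trace = 0 := by simpa [mulVecE_zero_right] using h4 0
  exact ⟨h5, fun x => by simpa [h5] using h4 x⟩

theorem inner_conjSqrt_nonneg (hK : K.PosDef) (h : (C, D) ∈ admissible K) (a : Space d) :
    0 ≤ ⟪a, mulVecE (conjSqrt K C) a⟫ := by
  have h1 := (trace_eq_zero_and_inner_eq_zero hK h.2.2).2 (sqrtL K a)
  rw [mulVecE_sub_left, inner_sub_right, sub_eq_zero, mulVecE_mul] at h1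
  rw [← inner_sqrtL hK, sqrtL_conjSqrt hK, inner_mulVecE_comm hK.inv.isHermitian, h1]
  exact inner_mulVecE_nonneg h.1 _

/-- Tested against the Gaussian with mean `m`, the adjoint Fokker-Planck operator reduces to the
transport operator with velocity `-C m`. -/
theorem integral_fInf_sub_mul_negLAdjoint (hK : K.PosDef) (h : (C, D) ∈ admissible K)
    {φ : Space d → ℝ} (hφ : ContDiff ℝ ∞ φ) (hc : HasCompactSupport φ) (m : Space d) :
    ∫ x, fInf K (x - m) * negLAdjoint C D φ x =
      ∫ x, fInf K (x - m) * fderiv ℝ φ x (-mulVecE C m) := by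
  obtain ⟨htr, hN⟩ := trace_eq_zero_and_inner_eq_zero (C := C) (D := D) hK h.2.2
  have hgc := hasCompactSupport_gradient hc
  have hgs := contDiff_gradient hφ
  have hE : ContDiff ℝ ∞ fun x => fInf K (x - m) := (contDiff_fInf K).comp (by fun_prop)
  have hDφ : ContDiff ℝ ∞ fun x => mulVecE D (gradient φ x) := (contDiff_mulVecE D).comp hgs
  have hNx : ContDiff ℝ ∞ fun x => mulVecE (C - D * K⁻¹) (x - m) :=
    (contDiff_mulVecE _).comp (by fun_prop)
  -- the divergence of `Z` is the difference of the two integrands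
  let Z : Space d → Space d := fun x => fInf K (x - m) • mulVecE D (gradient φ x) -
    (φ x * fInf K (x - m)) • mulVecE (C - D * K⁻¹) (x - m)
  have hZ : ContDiff ℝ ∞ Z := (hE.smul hDφ).sub ((hφ.mul hE).smul hNx)
  have hZc : HasCompactSupport Z := by
    have h1 : HasCompactSupport fun x => mulVecE D (gradient φ x) :=
      hgc.comp_left (g := mulVecE D) (mulVecE_zero_right D)
    have h2 : HasCompactSupport fun x => φ x * fInf K (x - m) := hc.mul_right
    exact (h1.smul_left (f := fun x => fInf K (x - m))).sub
      (h2.smul_right (f' := fun x => mulVecE (C - D * K⁻¹) (x - m)))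
  have hgE : ∀ x, gradient (fun x => fInf K (x - m)) x =
      -(fInf K (x - m)) • mulVecE K⁻¹ (x - m) := fun x => by
    rw [← gradient_fInf hK, gradient, gradient, fderiv_comp_sub]
  have hdiv : ∀ x, fInf K (x - m) * negLAdjoint C D φ x =
      divergence Z x + fInf K (x - m) * fderiv ℝ φ x (-mulVecE C m) := by
    intro x
    have hgφE : gradient (fun x => φ x * fInf K (x - m)) x =
        φ x • gradient (fun x => fInf K (x - m)) x + fInf K (x - m) • gradient φ x := by
      rw [gradient, fderiv_fun_mul (hφ.differentiable (by simp) x)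
        (hE.differentiable (by simp) x)]
      simp [gradient]
    have hNe : mulVecE (C - D * K⁻¹) (x - m) =
        mulVecE C x - mulVecE C m - mulVecE D (mulVecE K⁻¹ (x - m)) := by
      rw [mulVecE_sub_left, mulVecE_mul, mulVecE_sub_right C]
    have hsym : ⟪mulVecE K⁻¹ (x - m), mulVecE D (gradient φ x)⟫ =
        ⟪gradient φ x, mulVecE D (mulVecE K⁻¹ (x - m))⟫ := by
      rw [inner_mulVecE_comm h.1.isHermitian, real_inner_comm]
    have hZsub := divergence_sub (V := fun x => fInf K (x - m) • mulVecE D (gradient φ x))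
      (W := fun x => (φ x * fInf K (x - m)) • mulVecE (C - D * K⁻¹) (x - m))
      ((hE.smul hDφ).differentiable (by simp) x)
      (((hφ.mul hE).smul hNx).differentiable (by simp) x)
    rw [show divergence Z x = _ from hZsub,
      divergence_smul (hE.differentiable (by simp) x) (hDφ.differentiable (by simp) x),
      divergence_smul ((hφ.mul hE).differentiable (by simp) x) (hNx.differentiable (by simp) x),
      divergence_mulVecE_sub, htr, hgφE, hgE, inner_add_left, real_inner_smul_left,
      real_inner_smul_left, real_inner_smul_left, real_inner_smul_left, hN, hNe, hsym,
      negLAdjoint, ← inner_gradient]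
    simp only [inner_sub_right, inner_neg_right, real_inner_comm (mulVecE C x)]
    ring
  simp_rw [hdiv]
  have hi1 : Integrable (divergence Z) := by
    refine Continuous.integrable_of_hasCompactSupport ?_ ?_
    · unfold divergence
      have := hZ.continuous_fderiv (by simp)
      fun_prop
    · refine (hZc.fderiv ℝ).comp_left
        (g := fun L : Space d →L[ℝ] Space d => ∑ i, L (EuclideanSpace.single i 1) i) ?_
      simp
  have hi2 : Integrable fun x => fInf K (x - m) * fderiv ℝ φ x (-mulVecE C m) := by
    refine Continuous.integrable_of_hasCompactSupport ?_ (hc.fderiv_apply ℝ _).mul_left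
    have := hφ.continuous_fderiv (by simp)
    fun_prop
  rw [integral_add hi1 hi2, integral_divergence_eq_zero (hZ.of_le (by simp)) hZc, zero_add]

end Stationarity

/-! ### Translates of the Gaussian against a test function -/

section Transport

variable {K : Matrix (Fin d) (Fin d) ℝ}

/-- As `m ↦ ∫ x, fInf K (x - m) * φ x` is a convolution, its derivative can be put on `φ`. -/
theorem hasFDerivAt_integral_fInf_sub_mul (hK : K.PosDef)
    {φ : Space d → ℝ} (hφ : ContDiff ℝ ∞ φ) (hc : HasCompactSupport φ) (m : Space d) :
    ∃ L : Space d →L[ℝ] ℝ, HasFDerivAt (fun m => ∫ x, fInf K (x - m) * φ x) L m ∧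
      ∀ v, L v = ∫ x, fInf K (x - m) * fderiv ℝ φ x v := by
  have hswap : ∀ ψ : Space d → ℝ, ∀ m, ∫ x, fInf K (x - m) * ψ x =
      convolution (fInf K) ψ (ContinuousLinearMap.mul ℝ ℝ) volume m := by
    intro ψ m
    rw [convolution_eq_swap]
    refine integral_congr_ae (ae_of_all _ fun x => ?_)
    simp only [ContinuousLinearMap.mul_apply']
    rw [← fInf_neg K (m - x), neg_sub]
  have hl : LocallyIntegrable (fInf K) := (integrable_fInf hK).locallyIntegrable
  simp_rw [hswap]
  refine ⟨_, hc.hasFDerivAt_convolution_right (ContinuousLinearMap.mul ℝ ℝ) hl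
    (hφ.of_le (by simp)) m, fun v => ?_⟩
  rw [convolution_precompR_apply _ hl (hc.fderiv ℝ) (hφ.continuous_fderiv (by simp))]

end Transport

/-! ### Piecewise smooth matrices -/

section PiecewiseSmooth

theorem PiecewiseSmooth.isTame_apply {A : ℝ → Matrix (Fin d) (Fin d) ℝ} (hA : PiecewiseSmooth A)
    (i j : Fin d) : IsTame fun t => A t i j := by
  obtain ⟨τ, h0, hmono, htop, hg⟩ := hA
  refine ⟨⟨range τ, countable_range τ, fun t ht hτ => ?_⟩, fun T => ?_⟩
  · have hex : ∃ n, t < τ n := (htop.eventually_gt_atTop t).exists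
    classical
    obtain ⟨n, hn⟩ : ∃ n, Nat.find hex = n + 1 := by
      refine Nat.exists_eq_succ_of_ne_zero fun h => ?_
      have h1 := Nat.find_spec hex
      rw [h, h0] at h1
      exact lt_asymm ht h1
    have h1 : t < τ (n + 1) := hn ▸ Nat.find_spec hex
    have h2 : τ n < t := by
      refine lt_of_le_of_ne (not_lt.1 (Nat.find_min hex (by omega))) fun h => hτ ⟨n, h⟩
    obtain ⟨g, hgs, hgA⟩ := hg n i j
    refine (hgs.continuousOn.continuousAt (Icc_mem_nhds h2 h1)).congr ?_
    filter_upwards [Ioo_mem_nhds h2 h1] with r hr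
    exact (hgA hr).symm
  · have hbd : ∀ n, ∃ M, ∀ t ∈ Icc 0 (τ n), ‖A t i j‖ ≤ M := by
      intro n
      induction n with
      | zero =>
        refine ⟨‖A 0 i j‖, fun t ht => ?_⟩
        rw [h0, Icc_self] at ht
        rw [mem_singleton_iff.1 ht]
      | succ n ih =>
        obtain ⟨M, hM⟩ := ih
        obtain ⟨g, hgs, hgA⟩ := hg n i j
        obtain ⟨N, hN⟩ := isCompact_Icc.exists_bound_of_continuousOn hgs.continuousOn
        refine ⟨max M (max N ‖A (τ (n + 1)) i j‖), fun t ht => ?_⟩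
        rcases le_or_gt t (τ n) with h1 | h1
        · exact le_max_of_le_left (hM t ⟨ht.1, h1⟩)
        · rcases ht.2.lt_or_eq with h2 | h2
          · refine le_max_of_le_right (le_max_of_le_left ?_)
            have h3 : A t i j = g t := hgA ⟨h1, h2⟩
            rw [h3]
            exact hN t ⟨h1.le, h2.le⟩
          · rw [h2]
            exact le_max_of_le_right (le_max_right _ _)
    obtain ⟨n, hn⟩ := (htop.eventually_ge_atTop T).exists
    obtain ⟨M, hM⟩ := hbd n
    exact ⟨M, fun t ht => hM t ⟨ht.1, ht.2.trans hn⟩⟩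

theorem PiecewiseSmooth.isTame_sum {A : ℝ → Matrix (Fin d) (Fin d) ℝ} (hA : PiecewiseSmooth A)
    {F : Type*} [NormedAddCommGroup F] [NormedSpace ℝ F] (v : Fin d → Fin d → F) :
    IsTame fun t => ∑ i, ∑ j, A t i j • v i j :=
  IsTame.sum _ fun i => IsTame.sum _ fun j =>
    (hA.isTame_apply i j).clm_comp ((ContinuousLinearMap.id ℝ ℝ).smulRight (v i j))

theorem PiecewiseSmooth.isTame_comp {A : ℝ → Matrix (Fin d) (Fin d) ℝ} (hA : PiecewiseSmooth A)
    {F : Type*} [NormedAddCommGroup F] [NormedSpace ℝ F] (L : Matrix (Fin d) (Fin d) ℝ →ₗ[ℝ] F) :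
    IsTame fun t => L (A t) := by
  have h : ∀ t, L (A t) = ∑ i, ∑ j, A t i j • L (Matrix.single i j 1) := by
    intro t
    conv_lhs => rw [Matrix.matrix_eq_sum_single (A t)]
    simp only [map_sum, ← map_smul, Matrix.smul_single, smul_eq_mul, mul_one]
  simp only [h]
  exact hA.isTame_sum _

end PiecewiseSmooth

/-! ### The weak right-hand side -/

section TamePairing

variable {K : Matrix (Fin d) (Fin d) ℝ} {C D : ℝ → Matrix (Fin d) (Fin d) ℝ}

theorem integral_sum_sum_mul {V ι : Type*} [Fintype ι] [MeasurableSpace V] {μ : Measure V}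
    (c : ι → ι → ℝ) {h : ι → ι → V → ℝ} (hi : ∀ i j, Integrable (h i j) μ) :
    Integrable (fun x => ∑ i, ∑ j, c i j * h i j x) μ ∧
      ∫ x, ∑ i, ∑ j, c i j * h i j x ∂μ = ∑ i, ∑ j, c i j * ∫ x, h i j x ∂μ := by
  have h1 : ∀ i, Integrable (fun x => ∑ j, c i j * h i j x) μ := fun i =>
    integrable_finsetSum _ fun j _ => (hi i j).const_mul _
  refine ⟨integrable_finsetSum _ fun i _ => h1 i, ?_⟩
  rw [integral_finsetSum _ fun i _ => h1 i]
  refine Finset.sum_congr rfl fun i _ => ?_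
  rw [integral_finsetSum _ fun j _ => (hi i j).const_mul _]
  simp only [integral_const_mul]

/-- The right-hand side of the weak equation is a bounded functional of the density, with a
coefficient that depends tamely on time. -/
theorem exists_negLAdjoint_pairing (hK : K.PosDef) (hC : PiecewiseSmooth C)
    (hD : PiecewiseSmooth D) {φ : Space d → ℝ} (hφ : ContDiff ℝ ∞ φ) (hc : HasCompactSupport φ) :
    ∃ Q : ℝ → H K →L[ℝ] ℝ, IsTame Q ∧
      ∀ r (g : H K), Q r g = ∫ x, g x * negLAdjoint (C r) (D r) φ x := by
  have hgc := hasCompactSupport_gradient hc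
  have hgs := contDiff_gradient hφ
  have hψ : ∀ i j : Fin d, ∃ Λ : H K →L[ℝ] ℝ, ∀ g : H K,
      Integrable (fun x => g x * (fderiv ℝ (gradient φ) x (EuclideanSpace.single i 1)) j) ∧
      Λ g = ∫ x, g x * (fderiv ℝ (gradient φ) x (EuclideanSpace.single i 1)) j := by
    intro i j
    refine exists_lebesguePairing hK ?_ ?_
    · have := hgs.continuous_fderiv (by simp)
      fun_prop
    · exact (hgc.fderiv ℝ).comp_left
        (g := fun L : Space d →L[ℝ] Space d => L (EuclideanSpace.single i 1) j) (by simp)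
  have hχ : ∀ i j : Fin d, ∃ Λ : H K →L[ℝ] ℝ, ∀ g : H K,
      Integrable (fun x => g x * (x j * gradient φ x i)) ∧
      Λ g = ∫ x, g x * (x j * gradient φ x i) := by
    intro i j
    refine exists_lebesguePairing hK ?_ (HasCompactSupport.mul_left ?_)
    · have := hgs.continuous
      fun_prop
    · exact hgc.comp_left (g := fun v : Space d => v i) (by simp)
  choose Ψ hΨ using hψ
  choose Χ hΧ using hχ
  refine ⟨fun r => (∑ i, ∑ j, D r i j • Ψ i j) + ∑ i, ∑ j, C r i j • (-Χ i j),
    (hD.isTame_sum _).add (hC.isTame_sum _), fun r g => ?_⟩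
  have h1 : ∀ x, g x * negLAdjoint (C r) (D r) φ x =
      (∑ i, ∑ j, D r i j *
        (g x * (fderiv ℝ (gradient φ) x (EuclideanSpace.single i 1)) j)) -
      ∑ i, ∑ j, C r i j * (g x * (x j * gradient φ x i)) := by
    intro x
    have h2 : ⟪mulVecE (C r) x, gradient φ x⟫ = ∑ i, ∑ j, C r i j * (x j * gradient φ x i) := by
      simp only [PiLp.inner_apply, mulVecE_apply, RCLike.inner_apply, conj_trivial,
        Finset.mul_sum]
      exact Finset.sum_congr rfl fun i _ => Finset.sum_congr rfl fun j _ => by ring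
    rw [negLAdjoint, divergence_mulVecE_comp _ (hgs.differentiable (by simp) x), h2, mul_sub,
      Finset.mul_sum, Finset.mul_sum]
    simp only [Finset.mul_sum, mul_left_comm]
  obtain ⟨h3, h4⟩ := integral_sum_sum_mul (D r) fun i j => (hΨ i j g).1
  obtain ⟨h5, h6⟩ := integral_sum_sum_mul (C r) fun i j => (hΧ i j g).1
  rw [integral_congr_ae (ae_of_all _ h1), integral_sub h3 h5, h4, h6]
  simp [← (hΨ _ _ g).2, ← (hΧ _ _ g).2, sub_eq_add_neg]

end TamePairing

/-! ### Propagators -/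

section Propagator

variable {K : Matrix (Fin d) (Fin d) ℝ} {C D : ℝ → Matrix (Fin d) (Fin d) ℝ} {s : ℝ}

open scoped MatrixOrder in
theorem isTame_neg_conjSqrt (K : Matrix (Fin d) (Fin d) ℝ) (hC : PiecewiseSmooth C) :
    IsTame fun t => -mulVecL (conjSqrt K (C t)) :=
  hC.isTame_comp (-(mulVecL ∘ₗ LinearMap.mulRight ℝ (CFC.sqrt K) ∘ₗ
    LinearMap.mulLeft ℝ (CFC.sqrt K)⁻¹))

theorem isODESolution_iff {A : ℝ → Matrix (Fin d) (Fin d) ℝ} {x : ℝ → Space d} :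
    IsODESolution A s x ↔ IsCaratheodorySol (fun t => -mulVecL (A t)) s x := Iff.rfl

theorem continuous_expVec (hK : K.PosDef) : Continuous (expVec hK) :=
  continuous_of_inner_eq_exp (inner_expVec hK)

/-- The exponential vectors are transported by the drift equation: a Gaussian density with
covariance `K` whose mean follows the drift solves the Fokker-Planck equation weakly. -/
theorem integral_expVec_sub_eq (hK : K.PosDef) (hCD : ∀ t, 0 ≤ t → (C t, D t) ∈ admissible K)
    (hC : PiecewiseSmooth C) (hs : 0 ≤ s) {a : ℝ → Space d}
    (ha : IsCaratheodorySol (fun t => -mulVecL (conjSqrt K (C t))) s a)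
    {φ : Space d → ℝ} (hφ : ContDiff ℝ ∞ φ) (hc : HasCompactSupport φ)
    {Q : ℝ → H K →L[ℝ] ℝ} (hQ : IsTame Q)
    (hQφ : ∀ r (g : H K), Q r g = ∫ x, g x * negLAdjoint (C r) (D r) φ x) {t : ℝ} (hst : s ≤ t) :
    (∫ x, expVec hK (a t) x * φ x) - (∫ x, expVec hK (a s) x * φ x) =
      ∫ r in s..t, Q r (expVec hK (a r)) := by
  have hB := isTame_neg_conjSqrt K hC
  obtain ⟨S, hS, hBS⟩ := hB.exists_countable
  have hint : ∀ (a : Space d) (ψ : Space d → ℝ),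
      ∫ x, expVec hK a x * ψ x = ∫ x, fInf K (x - sqrtL K a) * ψ x := by
    intro a ψ
    refine integral_congr_ae ?_
    filter_upwards [coeFn_expVec hK a] with x hx
    rw [hx]
  choose L hL hLv using hasFDerivAt_integral_fInf_sub_mul hK hφ hc
  have hcont : Continuous fun m => ∫ x, fInf K (x - m) * φ x :=
    continuous_iff_continuousAt.2 fun m => (hL m).continuousAt
  simp_rw [hint]
  symm
  refine integral_eq_of_hasDerivAt_off_countable
    (fun r => ∫ x, fInf K (x - sqrtL K (a r)) * φ x) _ hS ?_ (fun r hr => ?_)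
    (hQ.intervalIntegrable_apply hs hst ((continuous_expVec hK).comp_continuousOn ha.1))
  · rw [uIcc_of_le hst]
    exact hcont.comp_continuousOn
      ((sqrtL K).continuous.comp_continuousOn (ha.1.mono Icc_subset_Ici_self))
  · rw [min_eq_left hst, max_eq_right hst] at hr
    have hr0 := hs.trans_lt hr.1.1
    have h1 := hB.hasDerivAt_caratheodorySol hs ha hr.1.1 (hBS r hr0 hr.2)
    have h2 := (hL (sqrtL K (a r))).comp_hasDerivAt r ((sqrtL K).hasFDerivAt.comp_hasDerivAt r h1)
    have h3 : L (sqrtL K (a r)) (sqrtL K ((-mulVecL (conjSqrt K (C r))) (a r))) =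
        Q r (expVec hK (a r)) := by
      rw [hLv, hQφ, hint, integral_fInf_sub_mul_negLAdjoint hK (hCD r hr0.le) hφ hc,
        neg_apply, map_neg, mulVecL_apply, sqrtL_conjSqrt hK]
    rw [← h3]
    exact h2

/-- The second quantization of the propagator of the drift equation solves the Fokker-Planck
equation, by linearity and density of the exponential vectors. -/
theorem isFPSolution_of_expVec (hK : K.PosDef) (hCD : ∀ t, 0 ≤ t → (C t, D t) ∈ admissible K)
    (hC : PiecewiseSmooth C) (hD : PiecewiseSmooth D) (hs : 0 ≤ s)
    {U : ℝ → Space d →L[ℝ] Space d}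
    (hU : ∀ v, IsCaratheodorySol (fun t => -mulVecL (conjSqrt K (C t))) s fun t => U t v)
    {Γ : ℝ → H K →L[ℝ] H K} (hΓ : ∀ t, s ≤ t → ∀ a, Γ t (expVec hK a) = expVec hK (U t a))
    (hΓn : ∀ t, s ≤ t → ∀ g, ‖Γ t g‖ ≤ ‖g‖) (g : H K) : IsFPSolution K C D s fun t => Γ t g := by
  have hd := dense_span_expVec hK
  have hcont : ∀ g, ContinuousOn (fun t => Γ t g) (Ici s) := fun g =>
    continuousOn_apply_of_dense hd hΓn (fun a =>
      ((continuous_expVec hK).comp_continuousOn (hU a).1).congr fun t ht => hΓ t ht a) g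
  refine ⟨hcont g, fun φ hφ hc t ht => ?_⟩
  obtain ⟨Q, hQ, hQφ⟩ := exists_negLAdjoint_pairing hK hC hD hφ hc
  obtain ⟨Λ, hΛ⟩ := exists_lebesguePairing hK hφ.continuous hc
  have hi : ∀ g, IntervalIntegrable (fun r => Q r (Γ r g)) volume s t := fun g =>
    hQ.intervalIntegrable_apply hs ht (hcont g)
  obtain ⟨M, hM⟩ := hQ.exists_bound t
  let J : H K →L[ℝ] ℝ := LinearMap.mkContinuous
    { toFun := fun g => ∫ r in s..t, Q r (Γ r g)
      map_add' := fun g h => by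
        simp only [map_add]
        exact intervalIntegral.integral_add (hi g) (hi h)
      map_smul' := fun c g => by
        simp only [map_smul]
        exact intervalIntegral.integral_smul c _ } (M * |t - s|) fun g => by
    have h1 : ‖∫ r in s..t, Q r (Γ r g)‖ ≤ (M * ‖g‖) * |t - s| := by
      refine intervalIntegral.norm_integral_le_of_norm_le_const fun r hr => ?_
      rw [uIoc_of_le ht] at hr
      exact (Q r).le_of_opNorm_le_of_le (hM r ⟨hs.trans hr.1.le, hr.2⟩) (hΓn r hr.1.le g)
    calc _ ≤ (M * ‖g‖) * |t - s| := h1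
      _ = M * |t - s| * ‖g‖ := by ring
  have hJ : Λ ∘L Γ t - Λ ∘L Γ s = J := by
    refine ContinuousLinearMap.ext_on hd ?_
    rintro _ ⟨a, rfl⟩
    have h2 := integral_expVec_sub_eq hK hCD hC hs (hU a) hφ hc hQ hQφ ht
    rw [← (hΛ _).2, ← (hΛ _).2] at h2
    change Λ (Γ t (expVec hK a)) - Λ (Γ s (expVec hK a)) = ∫ r in s..t, Q r (Γ r (expVec hK a))
    rw [hΓ t ht, hΓ s le_rfl, h2]
    refine intervalIntegral.integral_congr fun r hr => ?_
    rw [uIcc_of_le ht] at hr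
    simp only [hΓ r hr.1]
  have h3 : Λ (Γ t g) - Λ (Γ s g) = ∫ r in s..t, Q r (Γ r g) :=
    congrArg (fun L : H K →L[ℝ] ℝ => L g) hJ
  simp only [← hQφ]
  rw [← (hΛ _).2, ← (hΛ _).2, h3]

/-- Well-posedness from time `0` implies uniqueness from any later time: the difference of two
solutions with the same datum extends by zero to a solution on `[0,∞)`. -/
theorem IsWellPosed.eq_of_isFPSolution (hwp : IsWellPosed K C D) (hK : K.PosDef)
    (hC : PiecewiseSmooth C) (hD : PiecewiseSmooth D) (hs : 0 ≤ s) {f₁ f₂ : ℝ → H K}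
    (h₁ : IsFPSolution K C D s f₁) (h₂ : IsFPSolution K C D s f₂) (h : f₁ s = f₂ s)
    {t : ℝ} (hst : s ≤ t) : f₁ t = f₂ t := by
  -- since the difference vanishes at `s`, composing it with `max s` is the extension by zero
  let w : ℝ → H K := fun r => f₁ (max s r) - f₂ (max s r)
  have hw0 : ∀ r, r ≤ s → w r = 0 := fun r hr => by simp [w, max_eq_left hr, h]
  have hw1 : ∀ r, s ≤ r → w r = f₁ r - f₂ r := fun r hr => by simp [w, max_eq_right hr]
  have hmax : ContinuousOn (fun r => max s r) (Ici (0 : ℝ)) := by fun_prop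
  have hwc : ContinuousOn w (Ici 0) :=
    (h₁.1.comp hmax fun r _ => le_max_left s r).sub (h₂.1.comp hmax fun r _ => le_max_left s r)
  have hw : IsFPSolution K C D 0 w := by
    refine ⟨hwc, fun φ hφ hc r hr => ?_⟩
    obtain ⟨Q, hQ, hQφ⟩ := exists_negLAdjoint_pairing hK hC hD hφ hc
    obtain ⟨Λ, hΛ⟩ := exists_lebesguePairing hK hφ.continuous hc
    have hz : ∀ u, u ≤ s → ∀ b, b ≤ u → ∫ r in b..u, Q r (w r) = 0 := by
      intro u hu b hb
      rw [intervalIntegral.integral_congr (g := fun _ => (0 : ℝ)), intervalIntegral.integral_zero]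
      intro r hr
      rw [uIcc_of_le hb] at hr
      simp [hw0 r (hr.2.trans hu)]
    simp only [← hQφ]
    rw [← (hΛ _).2, ← (hΛ _).2, hw0 0 hs, map_zero, sub_zero]
    rcases le_total r s with hrs | hsr
    · rw [hz r hrs 0 hr, hw0 r hrs, map_zero]
    · have e₁ := h₁.2 φ hφ hc r hsr
      have e₂ := h₂.2 φ hφ hc r hsr
      simp only [← hQφ] at e₁ e₂
      rw [← (hΛ _).2, ← (hΛ _).2] at e₁ e₂
      have hint : IntervalIntegrable (fun r => Q r (w r)) volume 0 r :=
        hQ.intervalIntegrable_apply le_rfl hr hwc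
      have hsub : uIcc (0 : ℝ) s ⊆ uIcc 0 r := by
        rw [uIcc_of_le hs, uIcc_of_le hr]
        exact Icc_subset_Icc_right hsr
      have hsub' : uIcc s r ⊆ uIcc 0 r := by
        rw [uIcc_of_le hsr, uIcc_of_le hr]
        exact Icc_subset_Icc_left hs
      rw [← intervalIntegral.integral_add_adjacent_intervals (hint.mono_set hsub)
        (hint.mono_set hsub'), hz s le_rfl 0 hs, zero_add,
        intervalIntegral.integral_congr (g := fun r => Q r (f₁ r) - Q r (f₂ r)),
        intervalIntegral.integral_sub (hQ.intervalIntegrable_apply hs hsr h₁.1)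
          (hQ.intervalIntegrable_apply hs hsr h₂.1), ← e₁, ← e₂, hw1 r hsr, map_sub, h]
      · ring
      · intro u hu
        rw [uIcc_of_le hsr] at hu
        simp [hw1 u hu.1]
  have h0 : IsFPSolution K C D 0 fun _ => (0 : H K) := by
    refine ⟨continuousOn_const, fun φ hφ hc r hr => ?_⟩
    obtain ⟨Q, hQ, hQφ⟩ := exists_negLAdjoint_pairing hK hC hD hφ hc
    simp only [← hQφ, map_zero, sub_self, intervalIntegral.integral_zero]
  have := (hwp 0).2 w (fun _ => 0) hw (hw0 0 hs) h0 rfl (mem_Ici.2 (hs.trans hst))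
  rw [hw1 t hst] at this
  exact sub_eq_zero.1 this

end Propagator

end FokkerPlanck

theorem mainTheorem2 {d : ℕ} (K : Matrix (Fin d) (Fin d) ℝ) (hK : K.PosDef)
    (C D : ℝ → Matrix (Fin d) (Fin d) ℝ)
    (hCD : ∀ t, 0 ≤ t → (C t, D t) ∈ FokkerPlanck.admissible K)
    (hC : FokkerPlanck.PiecewiseSmooth C) (hD : FokkerPlanck.PiecewiseSmooth D)
    (hwp : FokkerPlanck.IsWellPosed K C D) :
    ∀ t₁ t₂ : ℝ, 0 ≤ t₁ → t₁ ≤ t₂ →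
      ∃ (S : FokkerPlanck.H K →L[ℝ] FokkerPlanck.H K)
        (T : FokkerPlanck.Space d →L[ℝ] FokkerPlanck.Space d),
        FokkerPlanck.IsFPPropagator K C D t₂ t₁ S ∧
        FokkerPlanck.IsODEPropagator (fun t => FokkerPlanck.conjSqrt K (C t)) t₂ t₁ T ∧
        (∀ g ∈ (FokkerPlanck.V0 K)ᗮ, S g ∈ (FokkerPlanck.V0 K)ᗮ) ∧
        ‖S ∘L ((FokkerPlanck.V0 K)ᗮ).subtypeL‖ = ‖T‖ := by
  intro t₁ t₂ h₁ h₁₂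
  open FokkerPlanck in
  have hκ := integral_fInf_pos hK
  have he := inner_expVec hK
  have hd := dense_span_expVec hK
  have hB := isTame_neg_conjSqrt K hC
  obtain ⟨U, hU1, -, hU⟩ := hB.exists_propagator h₁
  have hUn : ∀ t, t₁ ≤ t → ‖U t‖ ≤ 1 := by
    refine fun t ht => (U t).opNorm_le_bound zero_le_one fun v => ?_
    have h := hB.norm_caratheodorySol_le h₁ (hU v) (fun r hr a => ?_) ht
    · simpa [hU1] using h
    · have := inner_conjSqrt_nonneg hK (hCD r hr) a
      simpa [mulVecL_apply] using this
  -- only the times `t₁ ≤ t` matter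
  have hex : ∀ t, ∃ Γ : H K →L[ℝ] H K, t₁ ≤ t →
      (∀ a, Γ (expVec hK a) = expVec hK (U t a)) ∧ ∀ v, ‖Γ v‖ ≤ ‖v‖ := by
    intro t
    by_cases ht : t₁ ≤ t
    · obtain ⟨Γ, hΓ⟩ := exists_secondQuantization hκ he hd (hUn t ht)
      exact ⟨Γ, fun _ => hΓ⟩
    · exact ⟨0, fun h => absurd h ht⟩
  choose Γ hΓ using hex
  have hsol := isFPSolution_of_expVec hK hCD hC hD h₁ hU (fun t ht => (hΓ t ht).1)
    (fun t ht => (hΓ t ht).2)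
  have hid : Γ t₁ = ContinuousLinearMap.id ℝ (H K) := by
    refine ContinuousLinearMap.ext_on hd ?_
    rintro _ ⟨a, rfl⟩
    simp [(hΓ t₁ le_rfl).1, hU1]
  refine ⟨Γ t₂, U t₂, fun g => ⟨⟨_, hsol g, by simp [hid]⟩, fun f hf hfg => ?_⟩,
    fun x₀ => ⟨⟨fun t => U t x₀, hU x₀, by simp [hU1]⟩, fun x hx hx₀ => ?_⟩, fun g hg => ?_, ?_⟩
  · exact hwp.eq_of_isFPSolution hK hC hD h₁ hf (hsol g) (by simp [hfg, hid]) h₁₂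
  · exact hB.caratheodorySol_unique h₁ (isODESolution_iff.1 hx) (hU x₀) (by simp [hx₀, hU1]) h₁₂
  · rw [V0_eq hK, mem_span_singleton_orthogonal_iff] at hg ⊢
    rw [inner_zero_secondQuantization he hd (hΓ t₂ h₁₂).1, hg]
  · rw [V0_eq hK]
    exact norm_secondQuantization_comp_subtypeL hκ he hd (hUn t₂ h₁₂) (hΓ t₂ h₁₂).1
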